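/- Let $q\in\mathbb R$ with $|q|<1$, let $\mathcal H=\ell^2(\mathbb Z)$ with canonical basis $(e_i)_{i\in\mathbb Z}$, and let $\mathcal F_q$ be the $q$-Fock space, i.e. the completion of the algebraic linear span of a vacuum vector $\Omega$ and the vectors $f_1\otimes\cdots\otimes f_n$ ($n\ge 1$, $f_j\in\mathcal H$) with respect to the inner product $$\langle f_1\otimes\cdots\otimes f_n,\,g_1\otimes\cdots\otimes g_m\rangle_q=\delta_{n,m}\sum_{\pi\in S_n}q^{i(\pi)}\langle f_1,g_{\pi(1)}\rangle\cdots\langle f_n,g_{\pi(n)}\rangle ,$$ where $i(\pi)$ is the number of inversions of $\pi$ (and $\Omega$ is the tensor with $n=0$, so that $\|\Omega\|=1$ and $\Omega$ is orthogonal to all tensors with $n\ge1$). Let $a_i^+$ be the bounded operator on $\mathcal F_q$ with $a_i^+\Omega=e_i$ and $a_i^+(f_1\otimes\cdots\otimes f_n)=e_i\otimes f_1\otimes\cdots\otimes f_n$, let $a_i=(a_i^+)^*$, and let $\mathcal R_q\subset\mathcal B(\mathcal F_q)$ be the $C^*$-algebra generated by $\{a_i : i\in\mathbb Z\}$ (it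 contains the identity $1$). Let $\alpha$ be the $*$-automorphism of $\mathcal R_q$ determined by $\alpha(a_i)=a_{i+1}$ for $i\in\mathbb Z$, and let $\omega(x)=\langle x\Omega,\Omega\rangle$ be the vacuum expectation on $\mathcal R_q$. Then $(\mathcal R_q,\alpha)$ is uniquely mixing with limit state $\omega$: $\omega$ is a state, and for every $x\in\mathcal R_q$ and every bounded linear functional $\varphi$ on $\mathcal R_q$, $$\lim_{n\to+\infty}\varphi(\alpha^n(x))=\varphi(1)\,\omega(x).$$ Moreover, $\omega$ is the unique $\alpha$-invariant state of $\mathcal R_q$: a bounded linear functional $\psi$ on $\mathcal R_q$ is a state with $\psi\circ\alpha=\psi$ if and only if $\psi=\omega$. -/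

import Mathlib

namespace QFock

open scoped ComplexConjugate Matrix ComplexOrder

/-- The number of inversions of a permutation. -/
def inversions {n : ℕ} (π : Equiv.Perm (Fin n)) : ℕ :=
  (Finset.univ.filter fun p : Fin n × Fin n => p.1 < p.2 ∧ π p.2 < π p.1).card

theorem inversions_inv {n : ℕ} (π : Equiv.Perm (Fin n)) : inversions π⁻¹ = inversions π := by
  unfold inversions
  refine Finset.card_bij' (fun p _ => (π⁻¹ p.2, π⁻¹ p.1)) (fun p _ => (π p.2, π p.1)) ?_ ?_ ?_ ?_
  · rintro ⟨a, b⟩ h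
    simp only [Finset.mem_filter, Finset.mem_univ, true_and] at h ⊢
    simpa using h.symm
  · rintro ⟨a, b⟩ h
    simp only [Finset.mem_filter, Finset.mem_univ, true_and] at h ⊢
    simpa using h.symm
  · rintro ⟨a, b⟩ h; simp
  · rintro ⟨a, b⟩ h; simp

theorem inversions_mul_inv {n : ℕ} (σ τ : Equiv.Perm (Fin n)) :
    inversions (τ * σ⁻¹) = (Finset.univ.filter fun p : Fin n × Fin n =>
      p.1 < p.2 ∧ ¬ (σ p.1 < σ p.2 ↔ τ p.1 < τ p.2)).card := by
  unfold inversions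
  refine Finset.card_bij'
    (fun p _ => if σ.symm p.1 < σ.symm p.2 then (σ.symm p.1, σ.symm p.2)
      else (σ.symm p.2, σ.symm p.1))
    (fun p _ => if σ p.1 < σ p.2 then (σ p.1, σ p.2) else (σ p.2, σ p.1)) ?_ ?_ ?_ ?_
  · rintro ⟨a, b⟩ h
    rw [Finset.mem_filter] at h ⊢
    obtain ⟨i, rfl⟩ := σ.surjective a
    obtain ⟨j, rfl⟩ := σ.surjective b
    obtain ⟨-, h1, h2⟩ := h
    have hij : i ≠ j := by rintro rfl; exact lt_irrefl _ h1
    simp only [Equiv.symm_apply_apply, Equiv.Perm.mul_apply, Equiv.Perm.inv_def] at h1 h2 ⊢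
    refine ⟨Finset.mem_univ _, ?_⟩
    split_ifs with h3
    · exact ⟨h3, by simp [h1, h2.le]⟩
    · exact ⟨lt_of_le_of_ne (not_lt.1 h3) hij.symm, by simp [h1.le, h2]⟩
  · rintro ⟨i, j⟩ h
    rw [Finset.mem_filter] at h ⊢
    obtain ⟨-, h1, h2⟩ := h
    simp only at h1 h2
    have hij : i ≠ j := h1.ne
    have h4 : τ i ≠ τ j := fun e => hij (τ.injective e)
    have h3 : σ i ≠ σ j := fun e => hij (σ.injective e)
    refine ⟨Finset.mem_univ _, ?_⟩
    simp only [Equiv.Perm.mul_apply, Equiv.Perm.inv_def]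
    split_ifs with h5
    · simp only [Equiv.symm_apply_apply]
      exact ⟨h5, lt_of_le_of_ne (by simpa [h5] using h2) h4.symm⟩
    · simp only [Equiv.symm_apply_apply]
      exact ⟨lt_of_le_of_ne (not_lt.1 h5) h3.symm, by simpa [h5] using h2⟩
  · rintro ⟨a, b⟩ h
    rw [Finset.mem_filter] at h
    obtain ⟨-, h1, -⟩ := h
    simp only at h1
    by_cases h3 : σ.symm a < σ.symm b <;> simp [h3, h1, h1.not_gt]
  · rintro ⟨a, b⟩ h
    rw [Finset.mem_filter] at h
    obtain ⟨-, h1, -⟩ := h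
    simp only at h1
    by_cases h3 : σ a < σ b <;> simp [h3, h1, h1.not_gt]

/-- The permutation `0 ↦ k`, `i + 1 ↦ k.succAbove (σ i)`. -/
theorem exists_perm_cons {n : ℕ} (k : Fin (n + 1)) (σ : Equiv.Perm (Fin n)) :
    ∃ π : Equiv.Perm (Fin (n + 1)), π 0 = k ∧ ∀ i, π i.succ = k.succAbove (σ i) := by
  have hb : Function.Bijective (Fin.cons k (fun i => k.succAbove (σ i)) : Fin (n+1) → Fin (n+1)) := by
    rw [← Finite.injective_iff_bijective, Fin.cons_injective_iff]
    refine ⟨by rintro ⟨i, hi⟩; exact Fin.succAbove_ne _ _ hi, ?_⟩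
    exact (Fin.succAbove_right_injective).comp σ.injective
  exact ⟨Equiv.ofBijective _ hb, by simp, by simp⟩

theorem inversions_cons {n : ℕ} (k : Fin (n + 1)) (σ : Equiv.Perm (Fin n))
    (π : Equiv.Perm (Fin (n + 1))) (h0 : π 0 = k) (hs : ∀ i, π i.succ = k.succAbove (σ i)) :
    inversions π = k + inversions σ := by
  have hk : ((k : ℕ)) = (Finset.univ.filter fun j : Fin n => k.succAbove (σ j) < k).card := by
    have : (Finset.univ.filter fun j : Fin n => k.succAbove (σ j) < k).card
        = (Finset.univ.filter fun j : Fin n => (j : ℕ) < k).card := by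
      refine Finset.card_bij' (fun j _ => σ j) (fun j _ => σ.symm j) ?_ ?_ (by simp) (by simp)
      · intro j hj
        rw [Finset.mem_filter, Fin.succAbove_lt_iff_castSucc_lt] at hj
        exact Finset.mem_filter.2 ⟨Finset.mem_univ _, hj.2⟩
      · intro j hj
        rw [Finset.mem_filter] at hj ⊢
        rw [Fin.succAbove_lt_iff_castSucc_lt, Equiv.apply_symm_apply]
        exact ⟨Finset.mem_univ _, hj.2⟩
    rw [this, Fin.card_filter_val_lt]
    omega
  unfold inversions
  conv_rhs => rw [hk]
  simp only [Finset.card_filter, Fintype.sum_prod_type]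
  rw [Fin.sum_univ_succ]
  congr 1
  · rw [Fin.sum_univ_succ]
    simp [h0, hs]
  · refine Finset.sum_congr rfl fun i _ => ?_
    rw [Fin.sum_univ_succ]
    simp [h0, hs]

theorem sum_perm_succ {n : ℕ} {M : Type*} [AddCommMonoid M]
    (F : Equiv.Perm (Fin (n + 1)) → M) (G : Fin (n + 1) → Equiv.Perm (Fin n) → M)
    (h : ∀ k σ π, π 0 = k → (∀ i : Fin n, π i.succ = k.succAbove (σ i)) → F π = G k σ) :
    ∑ π, F π = ∑ k, ∑ σ, G k σ := by
  choose e he0 hes using @exists_perm_cons n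
  rw [← Fintype.sum_prod_type']
  symm
  refine Fintype.sum_bijective (fun p : Fin (n + 1) × Equiv.Perm (Fin n) => e p.1 p.2) ?_ _ _
    (fun p => (h _ _ _ (he0 _ _) (hes _ _)).symm)
  rw [Fintype.bijective_iff_injective_and_card]
  refine ⟨?_, ?_⟩
  · rintro ⟨k, σ⟩ ⟨l, τ⟩ hp
    simp only at hp
    have hkl : k = l := by rw [← he0 k σ, hp, he0]
    subst hkl
    refine Prod.ext rfl (Equiv.ext fun i => ?_)
    have := congrArg (fun π => π i.succ) hp
    simp only [hes] at this
    exact Fin.succAbove_right_injective this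
  · simp [Fintype.card_perm, Nat.factorial_succ]


section Form

variable {H : Type*} [NormedAddCommGroup H] [InnerProductSpace ℂ H]

/-- `⟨f₁ ⊗ ⋯ ⊗ fₙ, g₁ ⊗ ⋯ ⊗ gₘ⟩_q = δ_{n,m} ∑_π q^{i(π)} ⟨f₁, g_{π(1)}⟩ ⋯ ⟨fₙ, g_{π(n)}⟩`
(conjugate linear in the first variable, as everywhere in Mathlib). -/
noncomputable def tensorInner (q : ℝ) (s t : Σ n : ℕ, (Fin n → H)) : ℂ :=
  if h : s.1 = t.1 then
    ∑ π : Equiv.Perm (Fin s.1),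
      (q : ℂ) ^ inversions π * ∏ k, inner ℂ (s.2 k) (t.2 (Fin.cast h (π k)))
  else 0

theorem tensorInner_mk (q : ℝ) {n : ℕ} (f g : Fin n → H) :
    tensorInner q ⟨n, f⟩ ⟨n, g⟩ =
      ∑ π : Equiv.Perm (Fin n), (q : ℂ) ^ inversions π * ∏ k, inner ℂ (f k) (g (π k)) := by
  simp [tensorInner]

theorem tensorInner_of_ne (q : ℝ) {s t : Σ n : ℕ, (Fin n → H)} (h : s.1 ≠ t.1) :
    tensorInner q s t = 0 := by
  simp [tensorInner, h]

theorem conj_tensorInner (q : ℝ) (s t : Σ n : ℕ, (Fin n → H)) :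
    conj (tensorInner q t s) = tensorInner q s t := by
  obtain ⟨n, f⟩ := s
  obtain ⟨m, g⟩ := t
  by_cases h : n = m
  · subst h
    rw [tensorInner_mk, tensorInner_mk, map_sum]
    refine Fintype.sum_equiv (Equiv.inv _) _ _ fun π => ?_
    simp only [Equiv.inv_apply, inversions_inv, map_mul, map_pow, Complex.conj_ofReal, map_prod,
      inner_conj_symm]
    congr 1
    exact Fintype.prod_equiv π _ _ fun k => by simp
  · rw [tensorInner_of_ne q (Ne.symm h), tensorInner_of_ne q h, map_zero]

theorem posSemidef_gram {X E : Type*} [Finite X] [NormedAddCommGroup E] [InnerProductSpace ℂ E]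
    (v : X → E) : (Matrix.of fun x y => inner ℂ (v x) (v y)).PosSemidef :=
  Matrix.posSemidef_gram (𝕜 := ℂ) v

theorem posSemidef_ones {X : Type*} [Finite X] :
    (Matrix.of fun _ _ : X => (1 : ℂ)).PosSemidef := by
  have e : (Matrix.of fun _ _ : X => (1 : ℂ)) =
      Matrix.of fun x y : X => inner ℂ ((fun _ => (1 : ℂ)) x) ((fun _ => (1 : ℂ)) y) := by
    ext; simp
  rw [e]
  exact posSemidef_gram _

theorem posSemidef_prod {X ι : Type*} [Finite X] (S : Finset ι) (A : ι → Matrix X X ℂ)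
    (h : ∀ i, (A i).PosSemidef) : (Matrix.of fun x y => ∏ i ∈ S, A i x y).PosSemidef := by
  classical
  induction S using Finset.induction_on with
  | empty => simpa using posSemidef_ones
  | insert i S hi ih =>
    have e : (Matrix.of fun x y => ∏ j ∈ insert i S, A j x y) =
        A i ⊙ (Matrix.of fun x y => ∏ j ∈ S, A j x y) := by
      ext x y
      simp [Finset.prod_insert hi]
    rw [e]
    exact (h i).hadamard ih

theorem posSemidef_ite {X : Type*} [Finite X] (q : ℝ) (hq : |q| ≤ 1) (P : X → Prop)
    [DecidablePred P] :
    (Matrix.of fun x y => if (P x ↔ P y) then (1 : ℂ) else q).PosSemidef := by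
  have h1 := (posSemidef_ones (X := X)).smul (a := (1 + q) / 2) (by linarith [(abs_le.1 hq).1])
  have h2 := (posSemidef_gram (fun x : X => if P x then (1 : ℂ) else -1)).smul
    (a := (1 - q) / 2) (by linarith [(abs_le.1 hq).2])
  convert h1.add h2 using 1
  ext x y
  by_cases hx : P x <;> by_cases hy : P y <;> simp [hx, hy] <;> ring

theorem factorial_mul_tensorInner (q : ℝ) {n : ℕ} (f g : Fin n → H) :
    (n.factorial : ℂ) * tensorInner q ⟨n, f⟩ ⟨n, g⟩ =
      ∑ σ : Equiv.Perm (Fin n), ∑ τ : Equiv.Perm (Fin n),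
        (∏ p ∈ Finset.univ.filter (fun p : Fin n × Fin n => p.1 < p.2),
          if (σ p.1 < σ p.2 ↔ τ p.1 < τ p.2) then (1 : ℂ) else q) *
        ∏ k, inner ℂ (f (σ k)) (g (τ k)) := by
  have : (n.factorial : ℂ) = ∑ _σ : Equiv.Perm (Fin n), 1 := by
    simp [Fintype.card_perm]
  rw [this, Finset.sum_mul]
  refine Finset.sum_congr rfl fun σ _ => ?_
  rw [one_mul, tensorInner_mk]
  refine (Fintype.sum_equiv (Equiv.mulRight σ⁻¹) _ _ fun τ => ?_).symm
  simp only [Equiv.coe_mulRight]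
  rw [inversions_mul_inv]
  congr 1
  · rw [Finset.prod_ite, Finset.prod_const_one, one_mul, Finset.prod_const, Finset.filter_filter]
  · exact Fintype.prod_equiv σ _ _ fun k => by simp

theorem sum_tensorInner_nonneg (q : ℝ) (hq : |q| ≤ 1) {n : ℕ}
    (S : Finset (Σ n : ℕ, (Fin n → H))) (hS : ∀ s ∈ S, s.1 = n)
    (c : (Σ n : ℕ, (Fin n → H)) → ℂ) :
    0 ≤ (∑ s ∈ S, ∑ t ∈ S, conj (c s) * c t * tensorInner q s t).re := by
  classical
  let f : S → Fin n → H := fun s k => s.1.2 (Fin.cast (hS s.1 s.2).symm k)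
  have hf : ∀ s : S, s.1 = ⟨n, f s⟩ := by
    rintro ⟨⟨m, g⟩, hs⟩
    obtain rfl : m = n := hS _ hs
    rfl
  let N : Matrix (S × Equiv.Perm (Fin n)) (S × Equiv.Perm (Fin n)) ℂ :=
    (Matrix.of fun x y => ∏ p ∈ Finset.univ.filter (fun p : Fin n × Fin n => p.1 < p.2),
      if (x.2 p.1 < x.2 p.2 ↔ y.2 p.1 < y.2 p.2) then (1 : ℂ) else q) ⊙
    (Matrix.of fun x y => ∏ k, inner ℂ (f x.1 (x.2 k)) (f y.1 (y.2 k)))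
  have hN : N.PosSemidef := by
    refine Matrix.PosSemidef.hadamard ?_ ?_
    · exact posSemidef_prod _ (fun (p : Fin n × Fin n) => Matrix.of
        fun (x y : S × Equiv.Perm (Fin n)) =>
          if (x.2 p.1 < x.2 p.2 ↔ y.2 p.1 < y.2 p.2) then (1 : ℂ) else q)
        fun p => posSemidef_ite q hq (fun x : S × Equiv.Perm (Fin n) => x.2 p.1 < x.2 p.2)
    · exact posSemidef_prod _ (fun k => Matrix.of fun (x y : S × Equiv.Perm (Fin n)) =>
        inner ℂ (f x.1 (x.2 k)) (f y.1 (y.2 k)))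
        fun k => posSemidef_gram fun x : S × Equiv.Perm (Fin n) => f x.1 (x.2 k)
  have key : (n.factorial : ℂ) * ∑ s ∈ S, ∑ t ∈ S, conj (c s) * c t * tensorInner q s t =
      star (fun x : S × Equiv.Perm (Fin n) => c x.1) ⬝ᵥ
        (N *ᵥ (fun x : S × Equiv.Perm (Fin n) => c x.1)) := by
    simp only [dotProduct, Matrix.mulVec, Fintype.sum_prod_type, Finset.mul_sum]
    rw [← Finset.sum_coe_sort S]
    refine Finset.sum_congr rfl fun s _ => ?_
    rw [← Finset.sum_coe_sort S, Finset.sum_comm]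
    refine Finset.sum_congr rfl fun t _ => ?_
    have h1 := factorial_mul_tensorInner q (f s) (f t)
    rw [← hf, ← hf] at h1
    rw [mul_left_comm, h1, Finset.mul_sum]
    refine Finset.sum_congr rfl fun σ _ => ?_
    rw [Finset.mul_sum]
    refine Finset.sum_congr rfl fun τ _ => ?_
    simp only [N, Matrix.hadamard_apply, Matrix.of_apply, Pi.star_apply, RCLike.star_def]
    ring
  have h0 := hN.dotProduct_mulVec_nonneg (fun x : S × Equiv.Perm (Fin n) => c x.1)
  rw [← key] at h0
  have h2 := (Complex.le_def.1 h0).1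
  have h3 : ((n.factorial : ℂ)) = ((n.factorial : ℝ) : ℂ) := by simp
  rw [h3, Complex.re_ofReal_mul] at h2
  exact (mul_nonneg_iff_of_pos_left (by positivity)).1 h2

end Form

section Span

variable {H : Type*} [NormedAddCommGroup H] [InnerProductSpace ℂ H]

/-- The sesquilinear extension of `tensorInner` to formal linear combinations of the symbols
`f₁ ⊗ ⋯ ⊗ fₙ` (the symbol with `n = 0` is the vacuum). -/
noncomputable def form (q : ℝ) (x y : (Σ n : ℕ, (Fin n → H)) →₀ ℂ) : ℂ :=
  x.sum fun s a => y.sum fun t b => conj a * b * tensorInner q s t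

theorem form_single (q : ℝ) (s t : Σ n : ℕ, (Fin n → H)) (a b : ℂ) :
    form q (Finsupp.single s a) (Finsupp.single t b) = conj a * b * tensorInner q s t := by
  simp [form]

theorem form_add_left (q : ℝ) (x y z : (Σ n : ℕ, (Fin n → H)) →₀ ℂ) :
    form q (x + y) z = form q x z + form q y z := by
  classical
  unfold form
  refine Finsupp.sum_add_index (by simp) ?_
  intro s _ a b
  rw [← Finsupp.sum_add]
  exact Finsupp.sum_congr fun t _ => by rw [map_add]; ring

theorem form_smul_left (q : ℝ) (x y : (Σ n : ℕ, (Fin n → H)) →₀ ℂ) (r : ℂ) :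
    form q (r • x) y = conj r * form q x y := by
  unfold form
  rw [Finsupp.sum_smul_index (by simp), Finsupp.mul_sum]
  refine Finsupp.sum_congr fun s _ => ?_
  rw [Finsupp.mul_sum]
  exact Finsupp.sum_congr fun t _ => by rw [map_mul]; ring

theorem conj_form (q : ℝ) (x y : (Σ n : ℕ, (Fin n → H)) →₀ ℂ) :
    conj (form q y x) = form q x y := by
  unfold form
  simp only [Finsupp.sum, map_sum, map_mul, conj_tensorInner, Complex.conj_conj]
  rw [Finset.sum_comm]
  exact Finset.sum_congr rfl fun s _ => Finset.sum_congr rfl fun t _ => by ring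

theorem form_add_right (q : ℝ) (x y z : (Σ n : ℕ, (Fin n → H)) →₀ ℂ) :
    form q x (y + z) = form q x y + form q x z := by
  rw [← conj_form, form_add_left, map_add, conj_form, conj_form]

theorem form_smul_right (q : ℝ) (x y : (Σ n : ℕ, (Fin n → H)) →₀ ℂ) (r : ℂ) :
    form q x (r • y) = r * form q x y := by
  rw [← conj_form, form_smul_left, map_mul, conj_form, Complex.conj_conj]

theorem form_zero_left (q : ℝ) (x : (Σ n : ℕ, (Fin n → H)) →₀ ℂ) : form q 0 x = 0 := by
  simp [form]

theorem form_zero_right (q : ℝ) (x : (Σ n : ℕ, (Fin n → H)) →₀ ℂ) : form q x 0 = 0 := by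
  simp [form]

theorem form_self_nonneg (q : ℝ) (hq : |q| ≤ 1) (x : (Σ n : ℕ, (Fin n → H)) →₀ ℂ) :
    0 ≤ (form q x x).re := by
  classical
  have h : form q x x = ∑ n ∈ x.support.image Sigma.fst,
      ∑ s ∈ x.support.filter (fun s => s.1 = n), ∑ t ∈ x.support.filter (fun s => s.1 = n),
        conj (x s) * x t * tensorInner q s t := by
    unfold form Finsupp.sum
    rw [← Finset.sum_fiberwise_of_maps_to (g := Sigma.fst)
      (fun s hs => Finset.mem_image_of_mem Sigma.fst hs)]
    refine Finset.sum_congr rfl fun n _ => Finset.sum_congr rfl fun s hs => ?_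
    refine (Finset.sum_subset (Finset.filter_subset _ _) fun t ht ht' => ?_).symm
    have h1 : s.1 = n := (Finset.mem_filter.1 hs).2
    have h2 : s.1 ≠ t.1 := fun e => ht' (Finset.mem_filter.2 ⟨ht, by rw [← e, h1]⟩)
    show conj (x s) * x t * tensorInner q s t = 0
    rw [tensorInner_of_ne q h2, mul_zero]
  rw [h, Complex.re_sum]
  exact Finset.sum_nonneg fun n _ =>
    sum_tensorInner_nonneg q hq (n := n) _ (fun s hs => (Finset.mem_filter.1 hs).2) _

/-- `a⁺(f)` on the symbols: `f₁ ⊗ ⋯ ⊗ fₙ ↦ f ⊗ f₁ ⊗ ⋯ ⊗ fₙ`. -/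
noncomputable def creatorSpan {K : Type*} (f : K) :
    ((Σ n : ℕ, (Fin n → K)) →₀ ℂ) →ₗ[ℂ] ((Σ n : ℕ, (Fin n → K)) →₀ ℂ) :=
  Finsupp.lmapDomain ℂ ℂ fun s => ⟨s.1 + 1, Fin.cons f s.2⟩

/-- The annihilator on a symbol: `f₁ ⊗ ⋯ ⊗ fₙ ↦ ∑ₖ q ^ (k - 1) ⟨f, fₖ⟩ f₁ ⊗ ⋯ f̌ₖ ⋯ ⊗ fₙ`. -/
noncomputable def annihilatorSymbol (q : ℝ) (f : H) :
    (Σ n : ℕ, (Fin n → H)) → ((Σ n : ℕ, (Fin n → H)) →₀ ℂ)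
  | ⟨0, _⟩ => 0
  | ⟨n + 1, g⟩ => ∑ k : Fin (n + 1),
      Finsupp.single ⟨n, fun i => g (k.succAbove i)⟩ ((q : ℂ) ^ (k : ℕ) * inner ℂ f (g k))

/-- The annihilator `a(f)` on formal linear combinations of symbols. -/
noncomputable def annihilatorSpan (q : ℝ) (f : H) :
    ((Σ n : ℕ, (Fin n → H)) →₀ ℂ) →ₗ[ℂ] ((Σ n : ℕ, (Fin n → H)) →₀ ℂ) :=
  Finsupp.linearCombination ℂ (annihilatorSymbol q f)

theorem creatorSpan_single {K : Type*} (f : K) (s : Σ n : ℕ, (Fin n → K)) (a : ℂ) :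
    creatorSpan f (Finsupp.single s a) = Finsupp.single ⟨s.1 + 1, Fin.cons f s.2⟩ a := by
  simp [creatorSpan]

theorem form_sum_right (q : ℝ) {ι : Type*} (S : Finset ι) (x : (Σ n : ℕ, (Fin n → H)) →₀ ℂ)
    (y : ι → ((Σ n : ℕ, (Fin n → H)) →₀ ℂ)) :
    form q x (∑ i ∈ S, y i) = ∑ i ∈ S, form q x (y i) := by
  classical
  induction S using Finset.induction_on with
  | empty => simp [form_zero_right]
  | insert i S hi ih => rw [Finset.sum_insert hi, Finset.sum_insert hi, form_add_right, ih]

theorem form_creatorSpan (q : ℝ) (f : H) (x y : (Σ n : ℕ, (Fin n → H)) →₀ ℂ) :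
    form q (creatorSpan f x) y = form q x (annihilatorSpan q f y) := by
  induction x using Finsupp.induction_linear with
  | zero => simp [form_zero_left]
  | add x x' h h' => rw [map_add, form_add_left, form_add_left, h, h']
  | single s a =>
    induction y using Finsupp.induction_linear with
    | zero => simp [form_zero_right]
    | add y y' h h' => rw [map_add, form_add_right, form_add_right, h, h']
    | single t b =>
      rw [creatorSpan_single, annihilatorSpan, Finsupp.linearCombination_single, form_smul_right,
        form_single]
      obtain ⟨n, g⟩ := s
      obtain ⟨m, h⟩ := t
      cases m with
      | zero =>
        rw [tensorInner_of_ne q (by simp)]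
        simp [annihilatorSymbol, form_zero_right]
      | succ m =>
        simp only [annihilatorSymbol, form_sum_right, form_single]
        by_cases hnm : n = m
        · subst hnm
          rw [tensorInner_mk, sum_perm_succ _ (fun k σ => (q : ℂ) ^ ((k : ℕ) + inversions σ) *
            (inner ℂ f (h k) * ∏ i, inner ℂ (g i) (h (k.succAbove (σ i)))))]
          · rw [Finset.mul_sum, Finset.mul_sum]
            refine Finset.sum_congr rfl fun k _ => ?_
            rw [tensorInner_mk]
            simp only [Finset.mul_sum]
            refine Finset.sum_congr rfl fun σ _ => ?_
            rw [pow_add]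
            ring
          · intro k σ π h0 hs
            rw [inversions_cons k σ π h0 hs, Fin.prod_univ_succ]
            simp [h0, hs]
        · rw [tensorInner_of_ne q (by simpa using hnm)]
          simp only [mul_zero]
          refine (mul_eq_zero_of_right _ (Finset.sum_eq_zero fun k _ => ?_)).symm
          rw [tensorInner_of_ne q hnm, mul_zero]

/-- The `q`-commutation relation on formal linear combinations. -/
theorem annihilatorSpan_creatorSpan (q : ℝ) (e f : H) (x : (Σ n : ℕ, (Fin n → H)) →₀ ℂ) :
    annihilatorSpan q e (creatorSpan f x) =
      (inner ℂ e f : ℂ) • x + (q : ℂ) • creatorSpan f (annihilatorSpan q e x) := by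
  induction x using Finsupp.induction_linear with
  | zero => simp
  | add x x' h h' =>
    simp only [map_add, smul_add, h, h']
    abel
  | single s a =>
    rw [creatorSpan_single]
    simp only [annihilatorSpan, Finsupp.linearCombination_single, map_smul]
    obtain ⟨n, g⟩ := s
    have main : annihilatorSymbol q e ⟨n + 1, Fin.cons f g⟩ =
        (inner ℂ e f : ℂ) • Finsupp.single ⟨n, g⟩ 1 +
          (q : ℂ) • creatorSpan f (annihilatorSymbol q e ⟨n, g⟩) := by
      simp only [annihilatorSymbol]
      rw [Fin.sum_univ_succ]
      congr 1
      · simp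
      · cases n with
        | zero => simp
        | succ n =>
          simp only [map_sum, creatorSpan_single, Finset.smul_sum]
          refine Finset.sum_congr rfl fun k _ => ?_
          rw [Finsupp.smul_single, smul_eq_mul]
          congr 1
          · congr 1
            funext i
            refine Fin.cases ?_ (fun j => ?_) i <;> simp
          · simp only [Fin.val_succ, Fin.cons_succ, pow_succ]
            ring
    have h1 : (Finsupp.single ⟨n, g⟩ a : (Σ n : ℕ, (Fin n → H)) →₀ ℂ) =
        a • Finsupp.single ⟨n, g⟩ 1 := by simp
    rw [main, h1, smul_add, smul_comm a, smul_comm a]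

theorem form_creatorSpan_self (q : ℝ) (f : H) (x : (Σ n : ℕ, (Fin n → H)) →₀ ℂ) :
    (form q (creatorSpan f x) (creatorSpan f x)).re = ‖f‖ ^ 2 * (form q x x).re +
      q * (form q (annihilatorSpan q f x) (annihilatorSpan q f x)).re := by
  have h : form q x (creatorSpan f (annihilatorSpan q f x)) =
      form q (annihilatorSpan q f x) (annihilatorSpan q f x) := by
    rw [← conj_form, form_creatorSpan, conj_form]
  rw [form_creatorSpan, annihilatorSpan_creatorSpan, form_add_right, form_smul_right,
    form_smul_right, h, inner_self_eq_norm_sq_to_K]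
  have : ((‖f‖ : ℂ)) ^ 2 = ((‖f‖ ^ 2 : ℝ) : ℂ) := by push_cast; rfl
  simp [this, -Complex.ofReal_pow]

end Span

section Bound

variable {H : Type*} [NormedAddCommGroup H] [InnerProductSpace ℂ H]

theorem annihilatorSpan_mem_supported (q : ℝ) (f : H) (n : ℕ)
    (x : (Σ n : ℕ, (Fin n → H)) →₀ ℂ)
    (hx : x ∈ Finsupp.supported ℂ ℂ {s : Σ n : ℕ, (Fin n → H) | s.1 < n + 1}) :
    annihilatorSpan q f x ∈ Finsupp.supported ℂ ℂ {s : Σ n : ℕ, (Fin n → H) | s.1 < n} := by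
  rw [annihilatorSpan, Finsupp.linearCombination_apply]
  refine Submodule.sum_mem _ fun s hs => Submodule.smul_mem _ _ ?_
  have h : s.1 < n + 1 := (Finsupp.mem_supported ℂ x).1 hx hs
  obtain ⟨m, g⟩ := s
  cases m with
  | zero => exact Submodule.zero_mem _
  | succ m =>
    refine Submodule.sum_mem _ fun k _ => Finsupp.single_mem_supported ℂ _ ?_
    simpa using h

theorem form_creatorSpan_le (q : ℝ) (hq : |q| < 1) (f : H) (C : ℝ) (hC : 0 < C)
    (hf : ‖f‖ ^ 2 ≤ C * (1 - |q|)) (x : (Σ n : ℕ, (Fin n → H)) →₀ ℂ) :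
    (form q (creatorSpan f x) (creatorSpan f x)).re ≤ C * (form q x x).re := by
  have key : ∀ x : (Σ n : ℕ, (Fin n → H)) →₀ ℂ,
      (form q (annihilatorSpan q f x) (annihilatorSpan q f x)).re ≤ C * (form q x x).re →
      (form q (creatorSpan f x) (creatorSpan f x)).re ≤ C * (form q x x).re := by
    intro x hx
    have h1 := form_self_nonneg q hq.le x
    have h2 := form_self_nonneg q hq.le (annihilatorSpan q f x)
    rw [form_creatorSpan_self]
    have h3 := mul_le_mul_of_nonneg_right (le_abs_self q) h2
    have h4 := mul_le_mul_of_nonneg_left hx (abs_nonneg q)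
    have h5 := mul_le_mul_of_nonneg_right hf h1
    linarith
  have main : ∀ (n : ℕ) (x : (Σ n : ℕ, (Fin n → H)) →₀ ℂ),
      x ∈ Finsupp.supported ℂ ℂ {s : Σ n : ℕ, (Fin n → H) | s.1 < n} →
      (form q (creatorSpan f x) (creatorSpan f x)).re ≤ C * (form q x x).re := by
    intro n
    induction n with
    | zero =>
      intro x hx
      have : x = 0 := by simpa using hx
      simp [this, form_zero_left]
    | succ n ih =>
      intro x hx
      refine key x ?_
      have h1 := ih _ (annihilatorSpan_mem_supported q f n x hx)
      set y := annihilatorSpan q f x with hy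
      have e1 : form q (creatorSpan f y) x = form q y y := form_creatorSpan q f y x
      have e2 : form q x (creatorSpan f y) = form q y y := by
        rw [← conj_form, e1, conj_form]
      have h2 := form_self_nonneg q hq.le ((C : ℂ) • x + (-1 : ℂ) • creatorSpan f y)
      simp only [form_add_left, form_add_right, form_smul_left, form_smul_right, e1, e2,
        Complex.conj_ofReal, map_neg, map_one, Complex.add_re, Complex.re_ofReal_mul, neg_mul,
        one_mul, Complex.neg_re] at h2
      have h3 : 0 ≤ C * (C * (form q x x).re - (form q y y).re) := by nlinarith
      have h4 := nonneg_of_mul_nonneg_right h3 hC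
      linarith
  refine main (x.support.sup Sigma.fst + 1) x ?_
  rw [Finsupp.mem_supported]
  intro s hs
  exact Nat.lt_succ_of_le (Finset.le_sup (f := Sigma.fst) hs)

end Bound

section Fock

/-- The algebraic linear span of the symbols `f₁ ⊗ ⋯ ⊗ fₙ`, `n = 0, 1, 2, …`, with the inner
product `⟨·, ·⟩_q`. -/
def FockSpan (H : Type*) (q : ℝ) (_hq : |q| < 1) : Type _ :=
  (Σ n : ℕ, (Fin n → H)) →₀ ℂ

noncomputable instance (H : Type*) (q : ℝ) (hq : |q| < 1) : AddCommGroup (FockSpan H q hq) :=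
  inferInstanceAs (AddCommGroup ((Σ n : ℕ, (Fin n → H)) →₀ ℂ))

noncomputable instance (H : Type*) (q : ℝ) (hq : |q| < 1) : Module ℂ (FockSpan H q hq) :=
  inferInstanceAs (Module ℂ ((Σ n : ℕ, (Fin n → H)) →₀ ℂ))

variable {H : Type*} [NormedAddCommGroup H] [InnerProductSpace ℂ H] {q : ℝ} {hq : |q| < 1}

noncomputable instance : PreInnerProductSpace.Core ℂ (FockSpan H q hq) where
  inner x y := form q x y
  conj_inner_symm x y := conj_form q x y
  re_inner_nonneg x := form_self_nonneg q hq.le x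
  add_left x y z := form_add_left q x y z
  smul_left x y r := form_smul_left q x y r

noncomputable instance : SeminormedAddCommGroup (FockSpan H q hq) :=
  InnerProductSpace.Core.toSeminormedAddCommGroup (𝕜 := ℂ)

noncomputable instance : InnerProductSpace ℂ (FockSpan H q hq) :=
  InnerProductSpace.ofCore inferInstance

theorem inner_span (x y : FockSpan H q hq) : (inner ℂ x y : ℂ) = form q x y := rfl

theorem norm_sq_span (x : FockSpan H q hq) : ‖x‖ ^ 2 = (form q x x).re := by
  rw [← inner_span, ← inner_self_eq_norm_sq (𝕜 := ℂ)]
  rfl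

/-- The `q`-deformed Fock space: the (Hausdorff) completion of `FockSpan`. Passing to the completion
identifies vectors at distance zero, so in it the symbols `f₁ ⊗ ⋯ ⊗ fₙ` are multilinear
(see `tensor_update_add` and `tensor_update_smul`). -/
def Fock (H : Type*) [NormedAddCommGroup H] [InnerProductSpace ℂ H] (q : ℝ) (hq : |q| < 1) :
    Type _ :=
  UniformSpace.Completion (FockSpan H q hq)

noncomputable instance : NormedAddCommGroup (Fock H q hq) :=
  inferInstanceAs (NormedAddCommGroup (UniformSpace.Completion (FockSpan H q hq)))

noncomputable instance : InnerProductSpace ℂ (Fock H q hq) :=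
  inferInstanceAs (InnerProductSpace ℂ (UniformSpace.Completion (FockSpan H q hq)))

instance : CompleteSpace (Fock H q hq) :=
  inferInstanceAs (CompleteSpace (UniformSpace.Completion (FockSpan H q hq)))

/-- The canonical map of the algebraic span into its completion. -/
noncomputable def toFock (q : ℝ) (hq : |q| < 1) : FockSpan H q hq →ₗᵢ[ℂ] Fock H q hq :=
  (UniformSpace.Completion.toComplₗᵢ :
    FockSpan H q hq →ₗᵢ[ℂ] UniformSpace.Completion (FockSpan H q hq))

theorem fock_induction {p : Fock H q hq → Prop} (x : Fock H q hq) (hp : IsClosed {x | p x})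
    (ih : ∀ x : FockSpan H q hq, p (toFock q hq x)) : p x :=
  UniformSpace.Completion.induction_on (α := FockSpan H q hq) x hp ih

/-- The continuous extension to the `q`-Fock space of a bounded operator on the algebraic span. -/
noncomputable def extend (T : FockSpan H q hq →L[ℂ] FockSpan H q hq) :
    Fock H q hq →L[ℂ] Fock H q hq :=
  (T.completion : UniformSpace.Completion (FockSpan H q hq) →L[ℂ]
    UniformSpace.Completion (FockSpan H q hq))

theorem extend_toFock (T : FockSpan H q hq →L[ℂ] FockSpan H q hq) (x : FockSpan H q hq) :
    extend T (toFock q hq x) = toFock q hq (T x) :=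
  ContinuousLinearMap.completion_apply_coe T x

/-- The symbol `f₁ ⊗ ⋯ ⊗ fₙ` as an element of the algebraic span. -/
noncomputable def spanTensor (q : ℝ) (hq : |q| < 1) {n : ℕ} (f : Fin n → H) : FockSpan H q hq :=
  Finsupp.single ⟨n, f⟩ (1 : ℂ)

/-- The vector `f₁ ⊗ ⋯ ⊗ fₙ` of the `q`-Fock space. -/
noncomputable def tensor (q : ℝ) (hq : |q| < 1) {n : ℕ} (f : Fin n → H) : Fock H q hq :=
  toFock q hq (spanTensor q hq f)

/-- The vacuum vector. -/
noncomputable def vacuum (H : Type*) [NormedAddCommGroup H] [InnerProductSpace ℂ H]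
    (q : ℝ) (hq : |q| < 1) : Fock H q hq :=
  tensor q hq (Fin.elim0 : Fin 0 → H)

theorem inner_tensor {n m : ℕ} (f : Fin n → H) (g : Fin m → H) :
    (inner ℂ (tensor q hq f) (tensor q hq g) : ℂ) = tensorInner q ⟨n, f⟩ ⟨m, g⟩ := by
  rw [tensor, tensor, LinearIsometry.inner_map_map, inner_span, spanTensor, spanTensor,
    form_single]
  simp

theorem exists_multilinear (q : ℝ) (s : Σ n : ℕ, (Fin n → H)) (n : ℕ) :
    ∃ M : MultilinearMap ℂ (fun _ : Fin n => H) ℂ, ∀ g, tensorInner q s ⟨n, g⟩ = M g := by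
  obtain ⟨m, f⟩ := s
  by_cases h : m = n
  · subst h
    refine ⟨∑ π : Equiv.Perm (Fin m), ((q : ℂ) ^ inversions π) •
      (MultilinearMap.mkPiAlgebra ℂ (Fin m) ℂ).compLinearMap
        (fun k => innerₛₗ ℂ (f (π.symm k))), fun g => ?_⟩
    rw [tensorInner_mk, sum_apply]
    refine Finset.sum_congr rfl fun π _ => ?_
    simp only [smul_apply, MultilinearMap.compLinearMap_apply,
      MultilinearMap.mkPiAlgebra_apply, smul_eq_mul, innerₛₗ_apply_apply]
    congr 1
    exact Fintype.prod_equiv π _ _ fun k => by simp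
  · exact ⟨0, fun g => by rw [tensorInner_of_ne q h]; rfl⟩

theorem form_ext (q : ℝ) (x y : (Σ n : ℕ, (Fin n → H)) →₀ ℂ)
    (h : ∀ s, form q (Finsupp.single s 1) x = form q (Finsupp.single s 1) y)
    (z : (Σ n : ℕ, (Fin n → H)) →₀ ℂ) : form q z x = form q z y := by
  induction z using Finsupp.induction_linear with
  | zero => rw [form_zero_left, form_zero_left]
  | add z z' h h' => rw [form_add_left, form_add_left, h, h']
  | single s a =>
    have e : (Finsupp.single s a : (Σ n : ℕ, (Fin n → H)) →₀ ℂ) = a • Finsupp.single s 1 := by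
      simp
    rw [e, form_smul_left, form_smul_left, h]

theorem coe_eq_of_form_eq (x y : FockSpan H q hq)
    (h : ∀ s, form q (Finsupp.single s 1) x = form q (Finsupp.single s 1) y) :
    toFock q hq x = toFock q hq y := by
  have h1 : ∀ z : FockSpan H q hq, (inner ℂ z x : ℂ) = inner ℂ z y := fun z =>
    form_ext q x y h z
  refine ext_inner_left ℂ fun z => ?_
  induction z using fock_induction with
  | hp => exact isClosed_eq (by fun_prop) (by fun_prop)
  | ih z => rw [LinearIsometry.inner_map_map, LinearIsometry.inner_map_map, h1]

theorem form_single_update_add (q : ℝ) (s : Σ n : ℕ, (Fin n → H)) {n : ℕ} (f : Fin n → H)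
    (i : Fin n) (u v : H) :
    form q (Finsupp.single s 1) (Finsupp.single ⟨n, Function.update f i (u + v)⟩ 1) =
      form q (Finsupp.single s 1) (Finsupp.single ⟨n, Function.update f i u⟩ 1 +
        Finsupp.single ⟨n, Function.update f i v⟩ 1) := by
  obtain ⟨M, hM⟩ := exists_multilinear q s n
  simp [form_add_right, form_single, hM]

theorem form_single_update_smul (q : ℝ) (s : Σ n : ℕ, (Fin n → H)) {n : ℕ} (f : Fin n → H)
    (i : Fin n) (c : ℂ) (u : H) :
    form q (Finsupp.single s 1) (Finsupp.single ⟨n, Function.update f i (c • u)⟩ 1) =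
      form q (Finsupp.single s 1) (c • Finsupp.single ⟨n, Function.update f i u⟩ 1) := by
  obtain ⟨M, hM⟩ := exists_multilinear q s n
  simp only [form_smul_right, form_single, hM, M.map_update_smul, smul_eq_mul]
  ring

theorem tensor_update_add {n : ℕ} (f : Fin n → H) (i : Fin n) (u v : H) :
    tensor q hq (Function.update f i (u + v)) =
      tensor q hq (Function.update f i u) + tensor q hq (Function.update f i v) := by
  rw [tensor, tensor, tensor, ← map_add]
  exact coe_eq_of_form_eq _ _ fun s => form_single_update_add q s f i u v

theorem tensor_update_smul {n : ℕ} (f : Fin n → H) (i : Fin n) (c : ℂ) (u : H) :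
    tensor q hq (Function.update f i (c • u)) = c • tensor q hq (Function.update f i u) := by
  rw [tensor, tensor, ← map_smul]
  exact coe_eq_of_form_eq _ _ fun s => form_single_update_smul q s f i c u

/-- `a⁺(f)` as a bounded operator on the algebraic span. -/
noncomputable def creatorPre (q : ℝ) (hq : |q| < 1) (f : H) :
    FockSpan H q hq →L[ℂ] FockSpan H q hq :=
  LinearMap.mkContinuous (σ := RingHom.id ℂ) (E := FockSpan H q hq) (F := FockSpan H q hq)
    (creatorSpan f) (√((‖f‖ ^ 2 + 1) / (1 - |q|))) fun x => by
      have h0 : 0 < 1 - |q| := by linarith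
      have h := form_creatorSpan_le q hq f ((‖f‖ ^ 2 + 1) / (1 - |q|)) (by positivity)
        (by rw [div_mul_cancel₀ _ h0.ne']; linarith) x
      refine le_of_sq_le_sq ?_ (by positivity)
      rw [mul_pow, Real.sq_sqrt (by positivity), norm_sq_span, norm_sq_span]
      exact h

/-- The creator `a⁺(f)` on the `q`-Fock space: the bounded operator with
`f₁ ⊗ ⋯ ⊗ fₙ ↦ f ⊗ f₁ ⊗ ⋯ ⊗ fₙ`. -/
noncomputable def creator (q : ℝ) (hq : |q| < 1) (f : H) : Fock H q hq →L[ℂ] Fock H q hq :=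
  extend (creatorPre q hq f)

/-- The annihilator `a(f)`, the adjoint of the creator `a⁺(f)`. -/
noncomputable def annihilator (q : ℝ) (hq : |q| < 1) (f : H) : Fock H q hq →L[ℂ] Fock H q hq :=
  ContinuousLinearMap.adjoint (creator q hq f)

theorem creator_coe (f : H) (x : FockSpan H q hq) :
    creator q hq f (toFock q hq x) = toFock q hq (creatorPre q hq f x) :=
  extend_toFock _ _

theorem creator_tensor (f : H) {n : ℕ} (g : Fin n → H) :
    creator q hq f (tensor q hq g) = tensor q hq (Fin.cons f g : Fin (n + 1) → H) := by
  rw [tensor, creator_coe]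
  congr 1
  exact creatorSpan_single f ⟨n, g⟩ 1

/-- `a(f)` on the algebraic span. -/
noncomputable def annihilatorPre (q : ℝ) (hq : |q| < 1) (f : H) :
    FockSpan H q hq →ₗ[ℂ] FockSpan H q hq :=
  annihilatorSpan q f

theorem inner_creatorPre (f : H) (x y : FockSpan H q hq) :
    (inner ℂ (creatorPre q hq f x) y : ℂ) = inner ℂ x (annihilatorPre q hq f y) :=
  form_creatorSpan q f x y

theorem annihilatorPre_creatorPre (e f : H) (x : FockSpan H q hq) :
    annihilatorPre q hq e (creatorPre q hq f x) =
      (inner ℂ e f : ℂ) • x + (q : ℂ) • creatorPre q hq f (annihilatorPre q hq e x) :=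
  annihilatorSpan_creatorSpan q e f x

theorem annihilator_coe (f : H) (x : FockSpan H q hq) :
    annihilator q hq f (toFock q hq x) = toFock q hq (annihilatorPre q hq f x) := by
  refine ext_inner_left ℂ fun z => ?_
  induction z using fock_induction with
  | hp => exact isClosed_eq (by fun_prop) (by fun_prop)
  | ih z =>
    rw [annihilator, ContinuousLinearMap.adjoint_inner_right, creator_coe,
      LinearIsometry.inner_map_map, LinearIsometry.inner_map_map, inner_creatorPre]

/-- The `q`-commutation relation `a(e) a⁺(f) - q a⁺(f) a(e) = ⟨e, f⟩ 1`. -/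
theorem annihilator_creator (e f : H) (x : Fock H q hq) :
    annihilator q hq e (creator q hq f x) =
      (inner ℂ e f : ℂ) • x + (q : ℂ) • creator q hq f (annihilator q hq e x) := by
  induction x using fock_induction with
  | hp =>
    have h1 : Continuous fun x : Fock H q hq => (inner ℂ e f : ℂ) • x := continuous_const_smul _
    have h2 : Continuous fun x : Fock H q hq =>
        (q : ℂ) • creator q hq f (annihilator q hq e x) :=
      (continuous_const_smul (q : ℂ)).comp
        ((creator q hq f).continuous.comp (annihilator q hq e).continuous)
    exact isClosed_eq ((annihilator q hq e).continuous.comp (creator q hq f).continuous)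
      (h1.fun_add h2)
  | ih x =>
    rw [creator_coe, annihilator_coe, annihilator_coe, creator_coe, annihilatorPre_creatorPre,
      map_add, map_smul, map_smul]

theorem annihilatorPre_vacuum (f : H) :
    annihilatorPre q hq f (spanTensor q hq (Fin.elim0 : Fin 0 → H)) = 0 := by
  show Finsupp.linearCombination ℂ (annihilatorSymbol q f) (Finsupp.single _ 1) = 0
  rw [Finsupp.linearCombination_single, one_smul]
  rfl

theorem annihilator_vacuum (f : H) : annihilator q hq f (vacuum H q hq) = 0 := by
  rw [vacuum, tensor, annihilator_coe, annihilatorPre_vacuum, map_zero]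

theorem annihilatorPre_spanTensor (f : H) {n : ℕ} (g : Fin (n + 1) → H) :
    annihilatorPre q hq f (spanTensor q hq g) = ∑ k : Fin (n + 1),
      ((q : ℂ) ^ (k : ℕ) * inner ℂ f (g k)) • spanTensor q hq (fun i => g (k.succAbove i)) := by
  show Finsupp.linearCombination ℂ (annihilatorSymbol q f) (Finsupp.single _ 1) = _
  rw [Finsupp.linearCombination_single, one_smul]
  refine Finset.sum_congr rfl fun k _ => ?_
  show _ = ((q : ℂ) ^ (k : ℕ) * inner ℂ f (g k)) •
    (Finsupp.single _ 1 : (Σ n : ℕ, (Fin n → H)) →₀ ℂ)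
  simp

theorem annihilator_tensor (f : H) {n : ℕ} (g : Fin (n + 1) → H) :
    annihilator q hq f (tensor q hq g) = ∑ k : Fin (n + 1),
      ((q : ℂ) ^ (k : ℕ) * inner ℂ f (g k)) • tensor q hq (fun i => g (k.succAbove i)) := by
  simp only [tensor, annihilator_coe, annihilatorPre_spanTensor, map_sum, map_smul]

/-- Second quantization of a unitary on the symbols: `f₁ ⊗ ⋯ ⊗ fₙ ↦ U f₁ ⊗ ⋯ ⊗ U fₙ`. -/
noncomputable def secondSpan (U : H ≃ₗᵢ[ℂ] H) :
    ((Σ n : ℕ, (Fin n → H)) →₀ ℂ) →ₗ[ℂ] ((Σ n : ℕ, (Fin n → H)) →₀ ℂ) :=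
  Finsupp.lmapDomain ℂ ℂ fun s => ⟨s.1, fun k => U (s.2 k)⟩

theorem secondSpan_single (U : H ≃ₗᵢ[ℂ] H) (s : Σ n : ℕ, (Fin n → H)) (a : ℂ) :
    secondSpan U (Finsupp.single s a) = Finsupp.single ⟨s.1, fun k => U (s.2 k)⟩ a := by
  simp [secondSpan]

theorem form_secondSpan (U : H ≃ₗᵢ[ℂ] H) (x y : (Σ n : ℕ, (Fin n → H)) →₀ ℂ) :
    form q (secondSpan U x) (secondSpan U y) = form q x y := by
  induction x using Finsupp.induction_linear with
  | zero => simp [form_zero_left]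
  | add x x' h h' => rw [map_add, form_add_left, form_add_left, h, h']
  | single s a =>
    induction y using Finsupp.induction_linear with
    | zero => simp [form_zero_right]
    | add y y' h h' => rw [map_add, form_add_right, form_add_right, h, h']
    | single t b =>
      rw [secondSpan_single, secondSpan_single, form_single, form_single]
      simp [tensorInner]

theorem secondSpan_symm (U : H ≃ₗᵢ[ℂ] H) (x : (Σ n : ℕ, (Fin n → H)) →₀ ℂ) :
    secondSpan U.symm (secondSpan U x) = x := by
  induction x using Finsupp.induction_linear with
  | zero => simp
  | add x x' h h' => rw [map_add, map_add, h, h']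
  | single s a => simp [secondSpan_single]

/-- Second quantization of a unitary on the algebraic span. -/
noncomputable def secondPre (q : ℝ) (hq : |q| < 1) (U : H ≃ₗᵢ[ℂ] H) :
    FockSpan H q hq →ₗᵢ[ℂ] FockSpan H q hq where
  toLinearMap := secondSpan U
  norm_map' x := by
    have h : ‖(show FockSpan H q hq from secondSpan U x)‖ ^ 2 = ‖x‖ ^ 2 := by
      rw [norm_sq_span, norm_sq_span]
      exact congrArg Complex.re (form_secondSpan U x x)
    exact (pow_left_inj₀ (norm_nonneg _) (norm_nonneg _) two_ne_zero).1 h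

theorem secondPre_symm (U : H ≃ₗᵢ[ℂ] H) (x : FockSpan H q hq) :
    secondPre q hq U.symm (secondPre q hq U x) = x :=
  secondSpan_symm U x

theorem second_symm (U : H ≃ₗᵢ[ℂ] H) (x : Fock H q hq) :
    extend (secondPre q hq U.symm).toContinuousLinearMap
      (extend (secondPre q hq U).toContinuousLinearMap x) = x := by
  induction x using fock_induction with
  | hp => exact isClosed_eq (by fun_prop) (by fun_prop)
  | ih x =>
    rw [extend_toFock, extend_toFock]
    exact congrArg _ (secondPre_symm U x)

/-- Second quantization of a unitary `U` of `H`: the unitary of the `q`-Fock space with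
`f₁ ⊗ ⋯ ⊗ fₙ ↦ U f₁ ⊗ ⋯ ⊗ U fₙ`. -/
noncomputable def secondQuantization (q : ℝ) (hq : |q| < 1) (U : H ≃ₗᵢ[ℂ] H) :
    Fock H q hq ≃ₗᵢ[ℂ] Fock H q hq where
  toLinearEquiv := LinearEquiv.ofLinearMap
    (extend (secondPre q hq U).toContinuousLinearMap : Fock H q hq →ₗ[ℂ] Fock H q hq)
    (extend (secondPre q hq U.symm).toContinuousLinearMap : Fock H q hq →ₗ[ℂ] Fock H q hq)
    (LinearMap.ext fun x => second_symm U.symm x) (LinearMap.ext fun x => second_symm U x)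
  norm_map' x := by
    show ‖extend (secondPre q hq U).toContinuousLinearMap x‖ = ‖x‖
    induction x using fock_induction with
    | hp => exact isClosed_eq (by fun_prop) (by fun_prop)
    | ih x =>
      rw [extend_toFock, LinearIsometry.norm_map,
        LinearIsometry.norm_map]
      exact (secondPre q hq U).norm_map x

theorem secondQuantization_coe (U : H ≃ₗᵢ[ℂ] H) (x : FockSpan H q hq) :
    secondQuantization q hq U (toFock q hq x) = toFock q hq (secondPre q hq U x) :=
  extend_toFock _ _

theorem secondQuantization_tensor (U : H ≃ₗᵢ[ℂ] H) {n : ℕ} (f : Fin n → H) :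
    secondQuantization q hq U (tensor q hq f) = tensor q hq fun k => U (f k) := by
  rw [tensor, secondQuantization_coe]
  congr 1
  exact secondSpan_single U ⟨n, f⟩ 1

theorem secondQuantization_creator (U : H ≃ₗᵢ[ℂ] H) (f : H) (x : Fock H q hq) :
    secondQuantization q hq U (creator q hq f x) =
      creator q hq (U f) (secondQuantization q hq U x) := by
  induction x using fock_induction with
  | hp => exact isClosed_eq (by fun_prop) (by fun_prop)
  | ih x =>
    rw [creator_coe, secondQuantization_coe, secondQuantization_coe, creator_coe]
    congr 1
    show secondSpan U (creatorSpan f x) = creatorSpan (U f) (secondSpan U x)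
    induction x using Finsupp.induction_linear with
    | zero => simp
    | add x x' h h' => rw [map_add, map_add, map_add, map_add, h, h']
    | single s a =>
      rw [creatorSpan_single, secondSpan_single, secondSpan_single, creatorSpan_single]
      congr 2
      funext k
      refine Fin.cases ?_ (fun j => ?_) k <;> simp

theorem conj_secondQuantization_creator (U : H ≃ₗᵢ[ℂ] H) (f : H) :
    (secondQuantization q hq U).conjStarAlgEquiv (creator q hq f) = creator q hq (U f) := by
  ext x
  rw [LinearIsometryEquiv.conjStarAlgEquiv_apply_apply, secondQuantization_creator,
    LinearIsometryEquiv.apply_symm_apply]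

theorem conj_secondQuantization_annihilator (U : H ≃ₗᵢ[ℂ] H) (f : H) :
    (secondQuantization q hq U).conjStarAlgEquiv (annihilator q hq f) =
      annihilator q hq (U f) := by
  rw [annihilator, annihilator, ← ContinuousLinearMap.star_eq_adjoint,
    ← ContinuousLinearMap.star_eq_adjoint, ← conj_secondQuantization_creator U f]
  exact (secondQuantization q hq U).conjStarAlgEquiv.map_star' _

end Fock

section Shift

/-- The Hilbert space `ℓ²(ℤ)`. -/
abbrev L2Z : Type := lp (fun _ : ℤ => ℂ) 2

/-- The canonical basis vector `e_i`. -/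
noncomputable def basisVec (i : ℤ) : L2Z := lp.single 2 i 1

theorem memℓp_translate (f : L2Z) (m : ℤ) : Memℓp (fun i : ℤ => (f (i + m) : ℂ)) 2 := by
  have h := lp.memℓp f
  rw [memℓp_gen_iff (by norm_num)] at h ⊢
  exact ((Equiv.addRight m).summable_iff (f := fun i : ℤ => ‖f i‖ ^ (2 : ENNReal).toReal)).2 h

/-- The bilateral shift of `ℓ²(ℤ)`, with `e_i ↦ e_{i+1}`. -/
noncomputable def bilateralShift : L2Z ≃ₗᵢ[ℂ] L2Z where
  toFun f := ⟨fun i => f (i + (-1)), memℓp_translate f (-1)⟩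
  invFun f := ⟨fun i => f (i + 1), memℓp_translate f 1⟩
  map_add' f g := rfl
  map_smul' c f := rfl
  left_inv f := by
    ext i
    show f (i + 1 + -1) = f i
    simp
  right_inv f := by
    ext i
    show f (i + -1 + 1) = f i
    simp
  norm_map' f := by
    show ‖(⟨fun i => f (i + (-1)), memℓp_translate f (-1)⟩ : L2Z)‖ = ‖f‖
    rw [lp.norm_eq_tsum_rpow (by norm_num), lp.norm_eq_tsum_rpow (by norm_num)]
    congr 1
    exact (Equiv.addRight (-1 : ℤ)).tsum_eq (fun i : ℤ => ‖f i‖ ^ (2 : ENNReal).toReal)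

theorem bilateralShift_basisVec (i : ℤ) : bilateralShift (basisVec i) = basisVec (i + 1) := by
  ext j
  show (basisVec i : ℤ → ℂ) (j + (-1)) = _
  simp only [basisVec, lp.single_apply]
  by_cases h : j = i + 1
  · subst h
    have : i + 1 + -1 = i := by ring
    simp
  · have : j + -1 ≠ i := fun e => h (by omega)
    simp [h, this]

theorem bilateralShift_symm_basisVec (i : ℤ) :
    bilateralShift.symm (basisVec i) = basisVec (i - 1) := by
  rw [LinearIsometryEquiv.symm_apply_eq, bilateralShift_basisVec, sub_add_cancel]

/-- The annihilator `a_i = a(e_i)` on the `q`-Fock space over `ℓ²(ℤ)`. -/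
noncomputable def ann (q : ℝ) (hq : |q| < 1) (i : ℤ) : Fock L2Z q hq →L[ℂ] Fock L2Z q hq :=
  annihilator q hq (basisVec i)

/-- The `C*`-algebra `R_q` generated by the annihilators `a_i`, `i ∈ ℤ`. -/
noncomputable def Rq (q : ℝ) (hq : |q| < 1) :
    StarSubalgebra ℂ (Fock L2Z q hq →L[ℂ] Fock L2Z q hq) :=
  (StarAlgebra.adjoin ℂ (Set.range (ann q hq))).topologicalClosure

instance (q : ℝ) (hq : |q| < 1) :
    IsClosed (Rq q hq : Set (Fock L2Z q hq →L[ℂ] Fock L2Z q hq)) :=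
  StarSubalgebra.isClosed_topologicalClosure _

theorem ann_mem (q : ℝ) (hq : |q| < 1) (i : ℤ) : ann q hq i ∈ Rq q hq :=
  StarSubalgebra.le_topologicalClosure _ (StarAlgebra.subset_adjoin ℂ _ ⟨i, rfl⟩)

/-- The restriction of a `*`-automorphism to an invariant `*`-subalgebra. -/
def restrictAut {A : Type*} [Ring A] [Algebra ℂ A] [StarRing A] [StarModule ℂ A]
    (e : A ≃⋆ₐ[ℂ] A) (S : StarSubalgebra ℂ A)
    (h : ∀ x ∈ S, e x ∈ S) (hs : ∀ x ∈ S, e.symm x ∈ S) : S ≃⋆ₐ[ℂ] S where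
  toFun x := ⟨e x, h x x.2⟩
  invFun x := ⟨e.symm x, hs x x.2⟩
  left_inv x := Subtype.ext (e.symm_apply_apply x)
  right_inv x := Subtype.ext (e.apply_symm_apply x)
  map_mul' x y := Subtype.ext (map_mul e (x : A) y)
  map_add' x y := Subtype.ext (map_add e (x : A) y)
  map_star' x := Subtype.ext (map_star e (x : A))
  map_smul' c x := Subtype.ext (map_smul e c (x : A))

theorem continuous_conj {K : Type*} [NormedAddCommGroup K] [InnerProductSpace ℂ K]
    [CompleteSpace K] (U : K ≃ₗᵢ[ℂ] K) : Continuous U.conjStarAlgEquiv := by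
  have : (U.conjStarAlgEquiv : (K →L[ℂ] K) → (K →L[ℂ] K)) = fun x =>
      (U : K →L[ℂ] K) ∘L x ∘L (U.symm : K →L[ℂ] K) := by
    funext x
    exact LinearIsometryEquiv.conjStarAlgEquiv_apply U x
  rw [this]
  fun_prop

theorem aut_mem_closure_adjoin {A : Type*} [TopologicalSpace A] [Ring A] [Algebra ℂ A]
    [StarRing A] [StarModule ℂ A] [IsTopologicalRing A] [ContinuousStar A]
    (e : A ≃⋆ₐ[ℂ] A) (he : Continuous e) (s : Set A) (h : ∀ x ∈ s, e x ∈ s) (x : A)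
    (hx : x ∈ (StarAlgebra.adjoin ℂ s).topologicalClosure) :
    e x ∈ (StarAlgebra.adjoin ℂ s).topologicalClosure := by
  have h1 : (StarAlgebra.adjoin ℂ s).topologicalClosure ≤
      ((StarAlgebra.adjoin ℂ s).topologicalClosure).comap (e : A →⋆ₐ[ℂ] A) := by
    refine StarSubalgebra.topologicalClosure_minimal (StarAlgebra.adjoin_le fun y hy => ?_) ?_
    · exact StarSubalgebra.le_topologicalClosure _ (StarAlgebra.subset_adjoin ℂ _ (h y hy))
    · exact (StarSubalgebra.isClosed_topologicalClosure _).preimage he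
  exact h1 hx

theorem conj_mem_closure_adjoin {K : Type*} [NormedAddCommGroup K] [InnerProductSpace ℂ K]
    [CompleteSpace K] (U : K ≃ₗᵢ[ℂ] K) (s : Set (K →L[ℂ] K))
    (h : ∀ x ∈ s, U.conjStarAlgEquiv x ∈ s) (x : K →L[ℂ] K)
    (hx : x ∈ (StarAlgebra.adjoin ℂ s).topologicalClosure) :
    U.conjStarAlgEquiv x ∈ (StarAlgebra.adjoin ℂ s).topologicalClosure :=
  aut_mem_closure_adjoin U.conjStarAlgEquiv (continuous_conj U) s h x hx

theorem conj_bilateralShift_mem (q : ℝ) (hq : |q| < 1)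
    (x : Fock L2Z q hq →L[ℂ] Fock L2Z q hq) (hx : x ∈ Rq q hq) :
    (secondQuantization q hq bilateralShift).conjStarAlgEquiv x ∈ Rq q hq := by
  refine conj_mem_closure_adjoin (secondQuantization q hq bilateralShift) (Set.range (ann q hq))
    ?_ x hx
  rintro _ ⟨i, rfl⟩
  refine ⟨i + 1, ?_⟩
  rw [ann, ann, conj_secondQuantization_annihilator, bilateralShift_basisVec]

theorem conj_bilateralShift_symm_mem (q : ℝ) (hq : |q| < 1)
    (x : Fock L2Z q hq →L[ℂ] Fock L2Z q hq) (hx : x ∈ Rq q hq) :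
    (secondQuantization q hq bilateralShift).conjStarAlgEquiv.symm x ∈ Rq q hq := by
  refine conj_mem_closure_adjoin (secondQuantization q hq bilateralShift).symm
    (Set.range (ann q hq)) ?_ x hx
  rintro _ ⟨i, rfl⟩
  refine ⟨i - 1, ?_⟩
  rw [← LinearIsometryEquiv.symm_conjStarAlgEquiv, StarAlgEquiv.eq_symm_apply, ann, ann,
    conj_secondQuantization_annihilator, bilateralShift_basisVec, sub_add_cancel]

/-- The right shift `α` of `R_q`: the restriction to `R_q` of the conjugation with the second
quantization of the bilateral shift. By `shift_ann` it is the automorphism with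
`α(a_i) = a_{i+1}`. -/
noncomputable def shift (q : ℝ) (hq : |q| < 1) : Rq q hq ≃⋆ₐ[ℂ] Rq q hq :=
  restrictAut (secondQuantization q hq bilateralShift).conjStarAlgEquiv (Rq q hq)
    (conj_bilateralShift_mem q hq) (conj_bilateralShift_symm_mem q hq)

theorem shift_ann (q : ℝ) (hq : |q| < 1) (i : ℤ) :
    shift q hq ⟨ann q hq i, ann_mem q hq i⟩ = ⟨ann q hq (i + 1), ann_mem q hq (i + 1)⟩ := by
  refine Subtype.ext ?_
  show (secondQuantization q hq bilateralShift).conjStarAlgEquiv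
    (annihilator q hq (basisVec i)) = annihilator q hq (basisVec (i + 1))
  rw [conj_secondQuantization_annihilator, bilateralShift_basisVec]

/-- The vector functional `x ↦ ⟨x ξ, ξ⟩` on a `*`-subalgebra of the bounded operators (in Mathlib's
convention, where the inner product is linear in the second variable, it is `⟪ξ, x ξ⟫`). -/
noncomputable def vectorFunctional {K : Type*} [NormedAddCommGroup K] [InnerProductSpace ℂ K]
    [CompleteSpace K] (S : StarSubalgebra ℂ (K →L[ℂ] K)) (ξ : K) : StrongDual ℂ S :=
  LinearMap.mkContinuous
    { toFun := fun x => inner ℂ ξ ((x : K →L[ℂ] K) ξ)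
      map_add' := fun x y => inner_add_right _ _ _
      map_smul' := fun c x => inner_smul_right _ _ _ }
    (‖ξ‖ * ‖ξ‖) fun x => by
      refine (norm_inner_le_norm _ _).trans ?_
      rw [mul_assoc, mul_comm ‖ξ‖ ‖x‖]
      exact mul_le_mul_of_nonneg_left (ContinuousLinearMap.le_opNorm _ _) (norm_nonneg _)

/-- The Fock vacuum expectation `ω(x) = ⟨x Ω, Ω⟩` on `R_q`. -/
noncomputable def vacuumExpectation (q : ℝ) (hq : |q| < 1) : StrongDual ℂ (Rq q hq) :=
  vectorFunctional (Rq q hq) (vacuum L2Z q hq)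

theorem vacuumExpectation_apply (q : ℝ) (hq : |q| < 1) (x : Rq q hq) :
    vacuumExpectation q hq x = inner ℂ (vacuum L2Z q hq)
      ((x : Fock L2Z q hq →L[ℂ] Fock L2Z q hq) (vacuum L2Z q hq)) := rfl

end Shift

section Dynamics

variable {A : Type*} [CStarAlgebra A]

/-- A state of a unital `C*`-algebra: a positive unital bounded linear functional. -/
def IsState (φ : StrongDual ℂ A) : Prop :=
  φ 1 = 1 ∧ ∀ x : A, 0 ≤ φ (star x * x)

/-- `(A, α)` is uniquely mixing, with limit state `ω`: for all `x ∈ A` and all bounded functionals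
`φ`, `φ (αⁿ(x)) → φ(1) ω(x)`. -/
def UniquelyMixingWith (α : A ≃⋆ₐ[ℂ] A) (ω : StrongDual ℂ A) : Prop :=
  IsState ω ∧ ∀ (x : A) (φ : StrongDual ℂ A),
    Filter.Tendsto (fun n : ℕ => φ (α^[n] x)) Filter.atTop (nhds (φ 1 * ω x))

end Dynamics

end QFock

/-!
The theorem rests on one estimate. For an orthonormal family `v`, the row operator
`(ξ_l) ↦ ∑ a⁺(v_l) ξ_l` on the `q`-Fock space has norm at most `(1 - |q|)^(-1/2)`, however many
terms it has (`norm_sq_sum_creator_le`). To see this, let `K` be the norm of `∑ a⁺(v_l) a(v_l)`.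
The `q`-commutation relation gives
`‖∑ a⁺(v_l) ξ_l‖² = ∑ ‖ξ_l‖² + q ∑ ⟨a(v_m) ξ_l, a(v_l) ξ_m⟩ ≤ (1 + |q| K) ∑ ‖ξ_l‖²`,
and `ξ_l = a(v_l) x` turns this into `K² ≤ (1 + |q| K) K`, so that `K ≤ (1 - |q|)⁻¹`.

If `x = a⁺_i Y`, then `αⁿ(x) = a⁺_{i+n} Y_n` with `‖Y_n‖ = ‖Y‖`, and the estimate bounds the norm of
a sum of `N` of these operators, with arbitrary unimodular coefficients, by a multiple of `√N`.
Hence `∑ |φ(αⁿ(x))| = O(√N)` over any `N` indices `n`, for each bounded functional `φ`, which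
forces `φ(αⁿ(x)) → 0 = φ(1) ω(x)` (`mixes_of_eq_creator_mul`). The elements with
`φ(αⁿ(x)) → φ(1) ω(x)` for all `φ` form a closed self-adjoint subspace containing `1`, so it contains
all Wick ordered words; these span a dense subspace of `R_q` (`mem_wickSpan_of_mem_adjoin`). Applied
to an invariant state `ψ` in place of `φ`, the convergence says `ψ = ω`.
-/

namespace QFock

open scoped ComplexConjugate ComplexOrder
open Filter Topology

/-! ### The norm of a row of creators -/

section RowBound

variable {H : Type*} [NormedAddCommGroup H] [InnerProductSpace ℂ H] {q : ℝ} {hq : |q| < 1}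

theorem adjoint_annihilator (f : H) :
    ContinuousLinearMap.adjoint (annihilator q hq f) = creator q hq f :=
  ContinuousLinearMap.adjoint_adjoint _

theorem inner_creator_left (f : H) (x y : Fock H q hq) :
    (inner ℂ (creator q hq f x) y : ℂ) = inner ℂ x (annihilator q hq f y) :=
  (ContinuousLinearMap.adjoint_inner_right _ _ _).symm

theorem inner_creator_creator (e f : H) (x y : Fock H q hq) :
    (inner ℂ (creator q hq e x) (creator q hq f y) : ℂ) =
      inner ℂ e f * inner ℂ x y +
        q * inner ℂ (annihilator q hq f x) (annihilator q hq e y) := by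
  rw [inner_creator_left, annihilator_creator, inner_add_right, inner_smul_right,
    inner_smul_right, ← inner_conj_symm x (creator q hq f _), inner_creator_left,
    inner_conj_symm]

variable {ι : Type*} {v : ι → H}

/-- A bound `K` for `∑ a⁺(v_l) a(v_l)` bounds the row operator `(ξ_l) ↦ ∑ a⁺(v_l) ξ_l`: expand the
square with the `q`-commutation relation. -/
theorem norm_sq_sum_creator_le_of_bound (hv : Orthonormal ℂ v) (F : Finset ι) (K : ℝ)
    (hK : ∀ x : Fock H q hq, ∑ m ∈ F, ‖annihilator q hq (v m) x‖ ^ 2 ≤ K * ‖x‖ ^ 2)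
    (ξ : ι → Fock H q hq) :
    ‖∑ l ∈ F, creator q hq (v l) (ξ l)‖ ^ 2 ≤ (1 + |q| * K) * ∑ l ∈ F, ‖ξ l‖ ^ 2 := by
  classical
  set g : ι → ι → ℝ := fun l m => ‖annihilator q hq (v m) (ξ l)‖ with hg
  have hterm : ∀ l m, (inner ℂ (creator q hq (v l) (ξ l)) (creator q hq (v m) (ξ m)) : ℂ).re ≤
      (if l = m then ‖ξ l‖ ^ 2 else 0) + |q| * ((g l m ^ 2 + g m l ^ 2) / 2) := by
    intro l m
    rw [inner_creator_creator, Complex.add_re]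
    refine add_le_add ?_ ?_
    · rw [orthonormal_iff_ite.1 hv]
      split_ifs with h
      · subst h
        rw [one_mul]
        exact (inner_self_eq_norm_sq (𝕜 := ℂ) (ξ l)).le
      · simp
    · refine (Complex.re_le_norm _).trans ?_
      rw [norm_mul, Complex.norm_real, Real.norm_eq_abs]
      refine mul_le_mul_of_nonneg_left ((norm_inner_le_norm _ _).trans ?_) (abs_nonneg q)
      have := two_mul_le_add_sq (g l m) (g m l)
      simp only [hg] at this ⊢
      linarith
  have hsum : ∑ l ∈ F, ∑ m ∈ F, g l m ^ 2 ≤ K * ∑ l ∈ F, ‖ξ l‖ ^ 2 := by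
    rw [Finset.mul_sum]
    exact Finset.sum_le_sum fun l _ => hK (ξ l)
  have hswap : ∑ l ∈ F, ∑ m ∈ F, g m l ^ 2 = ∑ l ∈ F, ∑ m ∈ F, g l m ^ 2 := Finset.sum_comm
  calc ‖∑ l ∈ F, creator q hq (v l) (ξ l)‖ ^ 2
      = ∑ l ∈ F, ∑ m ∈ F,
          (inner ℂ (creator q hq (v l) (ξ l)) (creator q hq (v m) (ξ m)) : ℂ).re := by
        rw [← inner_self_eq_norm_sq (𝕜 := ℂ), sum_inner]
        simp only [inner_sum, map_sum]
        rfl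
    _ ≤ ∑ l ∈ F, ∑ m ∈ F,
          ((if l = m then ‖ξ l‖ ^ 2 else 0) + |q| * ((g l m ^ 2 + g m l ^ 2) / 2)) :=
        Finset.sum_le_sum fun l _ => Finset.sum_le_sum fun m _ => hterm l m
    _ = ∑ l ∈ F, ‖ξ l‖ ^ 2 + |q| * ∑ l ∈ F, ∑ m ∈ F, g l m ^ 2 := by
        simp only [Finset.sum_add_distrib, ← Finset.mul_sum, ← Finset.sum_div, hswap]
        rw [add_self_div_two]
        congr 1
        exact Finset.sum_congr rfl fun l hl => by simp [hl]
    _ ≤ (1 + |q| * K) * ∑ l ∈ F, ‖ξ l‖ ^ 2 := by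
        have := mul_le_mul_of_nonneg_left hsum (abs_nonneg q)
        linarith

/-- The operator `∑ a⁺(v_l) a(v_l)` of an orthonormal family has norm at most
`(1 - |q|)⁻¹`, uniformly in the number of terms: its norm `K` is finite, and
`norm_sq_sum_creator_le_of_bound` turns the bound `K` into `K ≤ 1 + |q| K`. -/
theorem sum_norm_sq_annihilator_le (hv : Orthonormal ℂ v) (F : Finset ι) (x : Fock H q hq) :
    ∑ m ∈ F, ‖annihilator q hq (v m) x‖ ^ 2 ≤ (1 - |q|)⁻¹ * ‖x‖ ^ 2 := by
  set S : Fock H q hq →L[ℂ] Fock H q hq :=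
    ∑ m ∈ F, creator q hq (v m) ∘L annihilator q hq (v m) with hS
  have hSx : ∀ x, S x = ∑ m ∈ F, creator q hq (v m) (annihilator q hq (v m) x) := fun x => by
    simp [hS]
  have hK : ∀ x : Fock H q hq, ∑ m ∈ F, ‖annihilator q hq (v m) x‖ ^ 2 ≤ ‖S‖ * ‖x‖ ^ 2 := by
    intro x
    have h1 : ∑ m ∈ F, ‖annihilator q hq (v m) x‖ ^ 2 = (inner ℂ (S x) x : ℂ).re := by
      rw [hSx, sum_inner, Complex.re_sum]
      refine Finset.sum_congr rfl fun m _ => ?_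
      rw [inner_creator_left]
      exact (inner_self_eq_norm_sq (𝕜 := ℂ) _).symm
    rw [h1]
    calc (inner ℂ (S x) x : ℂ).re ≤ ‖S x‖ * ‖x‖ :=
          (Complex.re_le_norm _).trans (norm_inner_le_norm _ _)
      _ ≤ ‖S‖ * ‖x‖ * ‖x‖ := by gcongr; exact S.le_opNorm x
      _ = ‖S‖ * ‖x‖ ^ 2 := by ring
  have h0 : 0 < 1 - |q| := by linarith
  have hc : 0 ≤ (1 + |q| * ‖S‖) * ‖S‖ := by positivity
  have hle : ‖S‖ ≤ √((1 + |q| * ‖S‖) * ‖S‖) := by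
    refine S.opNorm_le_bound (Real.sqrt_nonneg _) fun x => ?_
    refine le_of_sq_le_sq ?_ (by positivity)
    rw [mul_pow, Real.sq_sqrt hc, hSx, mul_assoc]
    refine (norm_sq_sum_creator_le_of_bound hv F ‖S‖ hK _).trans ?_
    exact mul_le_mul_of_nonneg_left (hK x) (by positivity)
  have hS1 : ‖S‖ ≤ (1 - |q|)⁻¹ := by
    rcases (norm_nonneg S).eq_or_lt with h | h
    · rw [← h]
      positivity
    · have h2 : ‖S‖ ^ 2 ≤ (1 + |q| * ‖S‖) * ‖S‖ := by
        rw [← Real.sq_sqrt hc]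
        gcongr
      have h3 : ‖S‖ ≤ 1 + |q| * ‖S‖ := le_of_mul_le_mul_right (by linarith [sq ‖S‖]) h
      rw [← one_div, le_div_iff₀ h0]
      linarith
  exact (hK x).trans (by gcongr)

/-- The row operator `(ξ_l) ↦ ∑ a⁺(v_l) ξ_l` of an orthonormal family has norm at most
`(1 - |q|)^(-1/2)`, uniformly in the number of terms. -/
theorem norm_sq_sum_creator_le (hv : Orthonormal ℂ v) (F : Finset ι) (ξ : ι → Fock H q hq) :
    ‖∑ l ∈ F, creator q hq (v l) (ξ l)‖ ^ 2 ≤ (1 - |q|)⁻¹ * ∑ l ∈ F, ‖ξ l‖ ^ 2 := by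
  have h0 : 1 - |q| ≠ 0 := by linarith
  have h := norm_sq_sum_creator_le_of_bound hv F _ (sum_norm_sq_annihilator_le hv F) ξ
  have e : 1 + |q| * (1 - |q|)⁻¹ = (1 - |q|)⁻¹ := by field_simp; ring
  rwa [e] at h

theorem norm_sum_creator_mul_le (hv : Orthonormal ℂ v) (F : Finset ι) (C : ℝ)
    (Y : ι → Fock H q hq →L[ℂ] Fock H q hq) (hY : ∀ l ∈ F, ‖Y l‖ ≤ C) :
    ‖∑ l ∈ F, creator q hq (v l) * Y l‖ ≤ √((1 - |q|)⁻¹ * C ^ 2 * F.card) := by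
  have h0 : 0 < 1 - |q| := by linarith
  refine ContinuousLinearMap.opNorm_le_bound _ (Real.sqrt_nonneg _) fun x => ?_
  refine le_of_sq_le_sq ?_ (by positivity)
  rw [mul_pow, Real.sq_sqrt (by positivity), sum_apply]
  refine (norm_sq_sum_creator_le hv F fun l => Y l x).trans ?_
  have h1 : ∑ l ∈ F, ‖Y l x‖ ^ 2 ≤ ∑ _l ∈ F, C ^ 2 * ‖x‖ ^ 2 := by
    refine Finset.sum_le_sum fun l hl => ?_
    rw [← mul_pow]
    exact pow_le_pow_left₀ (norm_nonneg _) ((Y l).le_of_opNorm_le (hY l hl) x) 2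
  rw [Finset.sum_const, nsmul_eq_mul] at h1
  calc (1 - |q|)⁻¹ * ∑ l ∈ F, ‖Y l x‖ ^ 2
      ≤ (1 - |q|)⁻¹ * (F.card * (C ^ 2 * ‖x‖ ^ 2)) :=
        mul_le_mul_of_nonneg_left h1 (by positivity)
    _ = (1 - |q|)⁻¹ * C ^ 2 * F.card * ‖x‖ ^ 2 := by ring

end RowBound

/-- A complex sequence tends to zero if its absolute values over `n` indices add up to `O(√n)`,
whichever the indices are: the number of indices with `ε ≤ ‖u n‖` is then `O(ε⁻²)`. -/
theorem tendsto_zero_of_sum_norm_le_sqrt (u : ℕ → ℂ) (D : ℝ)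
    (h : ∀ F : Finset ℕ, ∑ n ∈ F, ‖u n‖ ≤ √(D * F.card)) :
    Tendsto u atTop (𝓝 0) := by
  rw [← Nat.cofinite_eq_atTop, tendsto_zero_iff_norm_tendsto_zero, Metric.tendsto_nhds]
  intro ε hε
  rw [eventually_cofinite]
  by_contra hinf
  -- `N` indices with `ε ≤ ‖u n‖` give `N ε ≤ √(D N)`, which fails for `N > D / ε ^ 2`.
  obtain ⟨F, hF, hcard⟩ := Set.Infinite.exists_subset_card_eq hinf (⌊D / ε ^ 2⌋₊ + 1)
  have h1 : F.card * ε ≤ ∑ n ∈ F, ‖u n‖ := by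
    rw [← nsmul_eq_mul]
    refine Finset.card_nsmul_le_sum _ _ _ fun n hn => ?_
    have := hF hn
    simpa using this
  have h2 : D / ε ^ 2 < F.card := by
    rw [hcard]
    push_cast
    exact Nat.lt_floor_add_one (D / ε ^ 2)
  have hpos : (0 : ℝ) < F.card := by rw [hcard]; positivity
  have h3 : (F.card * ε) ^ 2 ≤ D * F.card := by
    have h4 := h1.trans (h F)
    have h5 : 0 < F.card * ε := by positivity
    have h6 := h5.trans_le h4
    exact (Real.le_sqrt' h5).1 h4
  rw [div_lt_iff₀ (by positivity)] at h2
  nlinarith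

/-! ### Weak convergence under the shift -/

section Mixing

variable {q : ℝ} {hq : |q| < 1}

theorem orthonormal_basisVec : Orthonormal ℂ basisVec := by
  rw [orthonormal_iff_ite]
  intro i j
  rw [basisVec, basisVec, lp.inner_single_left]
  by_cases h : i = j
  · subst h; simp
  · simp [lp.single_apply, h]

theorem coe_shift (x : Rq q hq) :
    (shift q hq x : Fock L2Z q hq →L[ℂ] Fock L2Z q hq) =
      (secondQuantization q hq bilateralShift).conjStarAlgEquiv x := rfl

theorem secondQuantization_vacuum {H : Type*} [NormedAddCommGroup H] [InnerProductSpace ℂ H]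
    (U : H ≃ₗᵢ[ℂ] H) :
    secondQuantization q hq U (vacuum H q hq) = vacuum H q hq := by
  rw [vacuum, secondQuantization_tensor]
  congr 1
  exact Subsingleton.elim _ _

theorem inner_vacuum_vacuum {H : Type*} [NormedAddCommGroup H] [InnerProductSpace ℂ H] :
    (inner ℂ (vacuum H q hq) (vacuum H q hq) : ℂ) = 1 := by
  rw [vacuum, inner_tensor, tensorInner_mk]
  simp [inversions]

theorem norm_shift_iterate (n : ℕ) (x : Rq q hq) : ‖(shift q hq)^[n] x‖ = ‖x‖ := by
  induction n with
  | zero => rfl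
  | succ n ih => rw [Function.iterate_succ_apply', StarAlgEquiv.norm_map, ih]

/-- The powers of `α` turn `a⁺_i Y` into `a⁺_{i+n} Y'`, where `Y'` is a unitary conjugate of `Y`. The
operator `Y` need not lie in `R_q`. -/
theorem exists_coe_shift_iterate (x : Rq q hq) (i : ℤ)
    (Y : Fock L2Z q hq →L[ℂ] Fock L2Z q hq)
    (hx : (x : Fock L2Z q hq →L[ℂ] Fock L2Z q hq) = creator q hq (basisVec i) * Y) (n : ℕ) :
    ∃ Y' : Fock L2Z q hq →L[ℂ] Fock L2Z q hq, ‖Y'‖ = ‖Y‖ ∧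
      ((shift q hq)^[n] x : Fock L2Z q hq →L[ℂ] Fock L2Z q hq) =
        creator q hq (basisVec (i + n)) * Y' := by
  induction n with
  | zero => exact ⟨Y, rfl, by simpa using hx⟩
  | succ n ih =>
    obtain ⟨Y', h1, h2⟩ := ih
    refine ⟨(secondQuantization q hq bilateralShift).conjStarAlgEquiv Y', ?_, ?_⟩
    · rw [StarAlgEquiv.norm_map, h1]
    · rw [Function.iterate_succ_apply', coe_shift, h2, map_mul, conj_secondQuantization_creator,
        bilateralShift_basisVec]
      push_cast
      rw [add_assoc]

/-- `φ(αⁿ(x)) → φ(1) ω(x)` for every bounded functional `φ` on `R_q`. -/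
def Mixes (x : Rq q hq) : Prop :=
  ∀ φ : StrongDual ℂ (Rq q hq), Tendsto (fun n : ℕ => φ ((shift q hq)^[n] x)) atTop
    (𝓝 (φ 1 * vacuumExpectation q hq x))

theorem vacuumExpectation_one : vacuumExpectation q hq 1 = 1 := by
  rw [vacuumExpectation_apply]
  exact inner_vacuum_vacuum

theorem mixes_one : Mixes (1 : Rq q hq) := by
  intro φ
  have h : ∀ n, (shift q hq)^[n] (1 : Rq q hq) = 1 := fun n =>
    Function.iterate_fixed (map_one _) n
  simp only [h, vacuumExpectation_one, mul_one]
  exact tendsto_const_nhds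

theorem Mixes.add {x y : Rq q hq} (hx : Mixes x) (hy : Mixes y) : Mixes (x + y) := by
  intro φ
  simp only [iterate_map_add, map_add, mul_add]
  exact (hx φ).add (hy φ)

theorem Mixes.smul {x : Rq q hq} (c : ℂ) (hx : Mixes x) : Mixes (c • x) := by
  intro φ
  have h : ∀ n, (shift q hq)^[n] (c • x) = c • (shift q hq)^[n] x := fun n =>
    (Function.Commute.iterate_left (g := fun y : Rq q hq => c • y)
      (fun y => map_smul (shift q hq) c y) n) x
  simp only [h, map_smul, smul_eq_mul, mul_left_comm _ c]
  exact (hx φ).const_mul c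

theorem mixes_zero : Mixes (0 : Rq q hq) := by
  rw [← zero_smul ℂ (1 : Rq q hq)]
  exact mixes_one.smul 0

/-- The functional `x ↦ conj (φ (star x))`. -/
noncomputable def conjDual {A : Type*} [CStarAlgebra A] (φ : StrongDual ℂ A) : StrongDual ℂ A :=
  LinearMap.mkContinuous
    { toFun := fun x => conj (φ (star x))
      map_add' := fun x y => by simp
      map_smul' := fun c x => by simp }
    ‖φ‖ fun x => by
      show ‖conj (φ (star x))‖ ≤ _
      rw [RCLike.norm_conj, ← norm_star x]
      exact φ.le_opNorm _

theorem conjDual_apply {A : Type*} [CStarAlgebra A] (φ : StrongDual ℂ A) (x : A) :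
    conjDual φ x = conj (φ (star x)) := rfl

theorem vacuumExpectation_star (x : Rq q hq) :
    vacuumExpectation q hq (star x) = conj (vacuumExpectation q hq x) := by
  rw [vacuumExpectation_apply, vacuumExpectation_apply, inner_conj_symm, StarMemClass.coe_star,
    ContinuousLinearMap.star_eq_adjoint, ContinuousLinearMap.adjoint_inner_right]

theorem Mixes.star {x : Rq q hq} (hx : Mixes x) : Mixes (star x) := by
  intro φ
  have h : ∀ n, (shift q hq)^[n] (Star.star x) = Star.star ((shift q hq)^[n] x) := by
    intro n
    induction n with
    | zero => rfl
    | succ n ih => rw [Function.iterate_succ_apply', ih, map_star, Function.iterate_succ_apply']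
  have h1 := (hx (conjDual φ)).star
  simpa [conjDual_apply, h, vacuumExpectation_star] using h1

/-- The mixing elements form a closed set, because the powers of `α` are isometric. -/
theorem mixes_of_approx (x : Rq q hq) (h : ∀ ε > 0, ∃ y : Rq q hq, Mixes y ∧ ‖x - y‖ < ε) :
    Mixes x := by
  unfold Mixes at *
  generalize vacuumExpectation q hq = ω at *
  intro φ
  rw [Metric.tendsto_nhds]
  intro ε hε
  set B := ‖φ‖ + ‖φ 1‖ * ‖ω‖ + 1 with hB
  have hBpos : 0 < B := by positivity
  obtain ⟨y, hy, hxy⟩ := h (ε / (2 * B)) (by positivity)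
  filter_upwards [(Metric.tendsto_nhds.1 (hy φ)) (ε / 2) (by positivity)] with n hn
  rw [dist_eq_norm] at hn ⊢
  have e : φ ((shift q hq)^[n] x) - φ 1 * ω x =
      φ ((shift q hq)^[n] (x - y)) + (φ ((shift q hq)^[n] y) - φ 1 * ω y) -
        φ 1 * ω (x - y) := by
    have h1 : φ ((shift q hq)^[n] (x - y)) = φ ((shift q hq)^[n] x) - φ ((shift q hq)^[n] y) :=
      (congrArg φ (iterate_map_sub (shift q hq) n x y)).trans (map_sub φ _ _)
    have h2 : ω (x - y) = ω x - ω y := map_sub ω x y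
    linear_combination φ 1 * h2 - h1
  have h1 : ‖φ ((shift q hq)^[n] (x - y))‖ ≤ ‖φ‖ * ‖x - y‖ := by
    rw [← norm_shift_iterate n (x - y)]
    exact φ.le_opNorm _
  have h2 : ‖φ 1 * ω (x - y)‖ ≤ ‖φ 1‖ * ‖ω‖ * ‖x - y‖ := by
    rw [norm_mul, mul_assoc]
    exact mul_le_mul_of_nonneg_left (ω.le_opNorm _) (norm_nonneg _)
  have h3 : B * ‖x - y‖ < ε / 2 := by
    rw [lt_div_iff₀ (by positivity)] at hxy
    linarith
  rw [e]
  have h4 := norm_sub_le (φ ((shift q hq)^[n] (x - y)) + (φ ((shift q hq)^[n] y) - φ 1 * ω y))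
    (φ 1 * ω (x - y))
  have h5 := norm_add_le (φ ((shift q hq)^[n] (x - y))) (φ ((shift q hq)^[n] y) - φ 1 * ω y)
  have h6 := norm_nonneg (x - y)
  have h7 : B * ‖x - y‖ = ‖φ‖ * ‖x - y‖ + ‖φ 1‖ * ‖ω‖ * ‖x - y‖ + ‖x - y‖ := by
    rw [hB]; ring
  linarith

/-- Elements `a⁺_i Y` mix, with limit zero: a sum of `N` of their translates under the powers of
`α`, with any coefficients of modulus one, has norm `O(√N)` by the row bound. -/
theorem mixes_of_eq_creator_mul (x : Rq q hq) (i : ℤ)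
    (Y : Fock L2Z q hq →L[ℂ] Fock L2Z q hq)
    (hx : (x : Fock L2Z q hq →L[ℂ] Fock L2Z q hq) = creator q hq (basisVec i) * Y) :
    Mixes x := by
  intro φ
  have hω : vacuumExpectation q hq x = 0 := by
    rw [vacuumExpectation_apply, hx, mul_apply_eq_comp, ← inner_conj_symm,
      inner_creator_left, annihilator_vacuum, inner_zero_right, map_zero]
  rw [hω, mul_zero]
  choose Y' hY' hxY using exists_coe_shift_iterate x i Y hx
  -- Unimodular `c n` with `c n * φ(αⁿ(x)) = ‖φ(αⁿ(x))‖`.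
  choose c hc1 hc using fun n => RCLike.exists_norm_eq_mul_self (φ ((shift q hq)^[n] x))
  have hv : Orthonormal ℂ fun n : ℕ => basisVec (i + n) :=
    orthonormal_basisVec.comp _ fun a b h => by simpa using h
  refine tendsto_zero_of_sum_norm_le_sqrt _ (‖φ‖ ^ 2 * ((1 - |q|)⁻¹ * ‖Y‖ ^ 2)) fun F => ?_
  have h1 : ((∑ n ∈ F, ‖φ ((shift q hq)^[n] x)‖ : ℝ) : ℂ) =
      φ (∑ n ∈ F, c n • (shift q hq)^[n] x) := by
    rw [map_sum]
    push_cast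
    exact Finset.sum_congr rfl fun n _ => by rw [map_smul, smul_eq_mul]; exact hc n
  have h2 : ‖∑ n ∈ F, c n • (shift q hq)^[n] x‖ ≤ √((1 - |q|)⁻¹ * ‖Y‖ ^ 2 * F.card) := by
    have h3 := norm_sum_creator_mul_le hv F ‖Y‖ (fun n => c n • Y' n)
      fun n _ => by rw [norm_smul, hc1, one_mul, hY']
    have h4 : ((∑ n ∈ F, c n • (shift q hq)^[n] x : Rq q hq) :
        Fock L2Z q hq →L[ℂ] Fock L2Z q hq) =
        ∑ n ∈ F, creator q hq (basisVec (i + n)) * (c n • Y' n) := by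
      rw [AddSubmonoidClass.coe_finsetSum]
      refine Finset.sum_congr rfl fun n _ => ?_
      rw [mul_smul_comm, ← hxY]
      rfl
    rw [← h4] at h3
    exact h3
  have h5 : ∑ n ∈ F, ‖φ ((shift q hq)^[n] x)‖ = ‖φ (∑ n ∈ F, c n • (shift q hq)^[n] x)‖ := by
    rw [← h1, Complex.norm_real, Real.norm_of_nonneg (by positivity)]
  rw [h5, mul_assoc, Real.sqrt_mul (by positivity), Real.sqrt_sq (norm_nonneg _)]
  exact (φ.le_opNorm _).trans (by gcongr)

end Mixing

/-! ### Wick ordering -/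

section Wick

variable (q : ℝ) (hq : |q| < 1)

/-- The span of the Wick ordered products: polynomials in the creators `a⁺_i` times polynomials in
the annihilators `a_j`. -/
noncomputable def wickSpan : Submodule ℂ (Fock L2Z q hq →L[ℂ] Fock L2Z q hq) :=
  Subalgebra.toSubmodule (Algebra.adjoin ℂ (Set.range fun i => creator q hq (basisVec i))) *
    Subalgebra.toSubmodule (Algebra.adjoin ℂ (Set.range (ann q hq)))

variable {q hq}

theorem ann_mul_creator (i j : ℤ) :
    ann q hq i * creator q hq (basisVec j) =
      (inner ℂ (basisVec i) (basisVec j) : ℂ) • 1 +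
        (q : ℂ) • (creator q hq (basisVec j) * ann q hq i) := by
  ext x
  exact annihilator_creator (basisVec i) (basisVec j) x

theorem one_mem_wickSpan : 1 ∈ wickSpan q hq := by
  rw [← one_mul (1 : Fock L2Z q hq →L[ℂ] Fock L2Z q hq)]
  exact Submodule.mul_mem_mul (Subalgebra.one_mem _) (Subalgebra.one_mem _)

theorem creator_mul_mem_wickSpan (i : ℤ) {w : Fock L2Z q hq →L[ℂ] Fock L2Z q hq}
    (hw : w ∈ wickSpan q hq) : creator q hq (basisVec i) * w ∈ wickSpan q hq := by
  induction hw using Submodule.mul_induction_on' with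
  | mem_mul_mem m hm n hn =>
    rw [← mul_assoc]
    exact Submodule.mul_mem_mul (Subalgebra.mul_mem _ (Algebra.subset_adjoin ⟨i, rfl⟩) hm) hn
  | add x _ y _ hx hy =>
    rw [mul_add]
    exact add_mem hx hy

/-- The `q`-commutation relation moves `a_i` to the right through the creators. -/
theorem ann_mul_mem_wickSpan (i : ℤ) {w : Fock L2Z q hq →L[ℂ] Fock L2Z q hq}
    (hw : w ∈ wickSpan q hq) : ann q hq i * w ∈ wickSpan q hq := by
  have key : ∀ p ∈ Algebra.adjoin ℂ (Set.range fun i => creator q hq (basisVec i)),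
      ∀ r ∈ Algebra.adjoin ℂ (Set.range (ann q hq)), ann q hq i * (p * r) ∈ wickSpan q hq := by
    intro p hp
    rw [← Subalgebra.mem_toSubmodule, Algebra.adjoin_eq_span] at hp
    induction hp using Submodule.span_induction with
    | zero => intro r _; simp
    | add x y _ _ hx hy =>
      intro r hr
      rw [add_mul, mul_add]
      exact add_mem (hx r hr) (hy r hr)
    | smul c x _ hx =>
      intro r hr
      rw [smul_mul_assoc, mul_smul_comm]
      exact Submodule.smul_mem _ _ (hx r hr)
    | mem x hx =>
      induction hx using Submonoid.closure_induction_left with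
      | one =>
        intro r hr
        rw [← one_mul (ann q hq i * (1 * r)), one_mul r]
        exact Submodule.mul_mem_mul (Subalgebra.one_mem _)
          (Subalgebra.mul_mem _ (Algebra.subset_adjoin ⟨i, rfl⟩) hr)
      | mul_left y hy x hx ih =>
        intro r hr
        obtain ⟨j, rfl⟩ := hy
        have hx' : x ∈ Algebra.adjoin ℂ (Set.range fun i => creator q hq (basisVec i)) :=
          Submonoid.closure_le (S := (Algebra.adjoin ℂ _).toSubmonoid).2
            Algebra.subset_adjoin hx
        have e : ann q hq i * (creator q hq (basisVec j) * x * r) =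
            (inner ℂ (basisVec i) (basisVec j) : ℂ) • (x * r) +
              (q : ℂ) • (creator q hq (basisVec j) * (ann q hq i * (x * r))) := by
          rw [mul_assoc, ← mul_assoc, ann_mul_creator, add_mul, smul_mul_assoc, smul_mul_assoc,
            one_mul, mul_assoc]
        show ann q hq i * (creator q hq (basisVec j) * x * r) ∈ _
        rw [e]
        exact add_mem (Submodule.smul_mem _ _ (Submodule.mul_mem_mul hx' hr))
          (Submodule.smul_mem _ _ (creator_mul_mem_wickSpan j (ih r hr)))
  induction hw using Submodule.mul_induction_on' with
  | mem_mul_mem m hm n hn => exact key m hm n hn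
  | add x _ y _ hx hy =>
    rw [mul_add]
    exact add_mem hx hy

theorem star_ann (i : ℤ) : star (ann q hq i) = creator q hq (basisVec i) := by
  rw [ContinuousLinearMap.star_eq_adjoint]
  exact adjoint_annihilator _

theorem creator_mem (i : ℤ) : creator q hq (basisVec i) ∈ Rq q hq := by
  rw [← star_ann]
  exact star_mem (ann_mem q hq i)

/-- Wick ordering: every polynomial in the `a_i` and `a⁺_i` is a combination of Wick ordered
products. -/
theorem mem_wickSpan_of_mem_adjoin {x : Fock L2Z q hq →L[ℂ] Fock L2Z q hq}
    (hx : x ∈ StarAlgebra.adjoin ℂ (Set.range (ann q hq))) : x ∈ wickSpan q hq := by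
  -- The operators that multiply the Wick span into itself form an algebra.
  have h : ∀ w ∈ wickSpan q hq, x * w ∈ wickSpan q hq := by
    rw [← StarSubalgebra.mem_toSubalgebra, StarAlgebra.adjoin_toSubalgebra] at hx
    induction hx using Algebra.adjoin_induction with
    | mem x hx =>
      intro w hw
      rcases hx with ⟨i, rfl⟩ | ⟨i, hi⟩
      · exact ann_mul_mem_wickSpan i hw
      · rw [← star_star x, ← hi, star_ann]
        exact creator_mul_mem_wickSpan i hw
    | algebraMap c =>
      intro w hw
      rw [← Algebra.smul_def]
      exact Submodule.smul_mem _ _ hw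
    | add x y _ _ hx hy =>
      intro w hw
      rw [add_mul]
      exact add_mem (hx w hw) (hy w hw)
    | mul x y _ _ hx hy =>
      intro w hw
      rw [mul_assoc]
      exact hx _ (hy w hw)
  simpa using h 1 one_mem_wickSpan

/-- A Wick ordered word is `1`, or begins with a creator, or ends with an annihilator; the last case
is the adjoint of the second. -/
theorem exists_mixes_of_mem_wickSpan {x : Fock L2Z q hq →L[ℂ] Fock L2Z q hq}
    (hx : x ∈ wickSpan q hq) :
    ∃ y : Rq q hq, (y : Fock L2Z q hq →L[ℂ] Fock L2Z q hq) = x ∧ Mixes y := by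
  rw [wickSpan, Algebra.adjoin_eq_span, Algebra.adjoin_eq_span, Submodule.span_mul_span] at hx
  have hc : ∀ p ∈ Submonoid.closure (Set.range fun i => creator q hq (basisVec i)),
      p ∈ Rq q hq := fun p hp =>
    Submonoid.closure_le (S := (Rq q hq).toSubmonoid).2
      (by rintro _ ⟨i, rfl⟩; exact creator_mem i) hp
  have ha : ∀ p ∈ Submonoid.closure (Set.range (ann q hq)), p ∈ Rq q hq := fun p hp =>
    Submonoid.closure_le (S := (Rq q hq).toSubmonoid).2
      (by rintro _ ⟨i, rfl⟩; exact ann_mem q hq i) hp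
  induction hx using Submodule.span_induction with
  | zero => exact ⟨0, rfl, mixes_zero⟩
  | add x y _ _ hx hy =>
    obtain ⟨x, rfl, hx⟩ := hx
    obtain ⟨y, rfl, hy⟩ := hy
    exact ⟨x + y, rfl, hx.add hy⟩
  | smul c x _ hx =>
    obtain ⟨x, rfl, hx⟩ := hx
    exact ⟨c • x, rfl, hx.smul c⟩
  | mem x hx =>
    obtain ⟨p, hp, r, hr, rfl⟩ := hx
    refine ⟨⟨p * r, mul_mem (hc p hp) (ha r hr)⟩, rfl, ?_⟩
    induction hp using Submonoid.closure_induction_left with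
    | mul_left y hy p hp _ =>
      obtain ⟨i, rfl⟩ := hy
      exact mixes_of_eq_creator_mul _ i (p * r) (mul_assoc _ _ _)
    | one =>
      induction hr using Submonoid.closure_induction_right with
      | one =>
        convert mixes_one (hq := hq) using 1
        exact Subtype.ext (one_mul 1)
      | mul_right r hr y hy _ =>
        obtain ⟨i, rfl⟩ := hy
        have h := (mixes_of_eq_creator_mul
          (star (⟨r * ann q hq i, mul_mem (ha r hr) (ann_mem q hq i)⟩ : Rq q hq)) i (star r)
          (by rw [StarMemClass.coe_star, star_mul, star_ann])).star
        simpa using h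

theorem mixes (x : Rq q hq) : Mixes x := by
  refine mixes_of_approx x fun ε hε => ?_
  have hx : (x : Fock L2Z q hq →L[ℂ] Fock L2Z q hq) ∈
      closure (StarAlgebra.adjoin ℂ (Set.range (ann q hq)) :
        Set (Fock L2Z q hq →L[ℂ] Fock L2Z q hq)) := x.2
  obtain ⟨y, hy, hxy⟩ := Metric.mem_closure_iff.1 hx ε hε
  obtain ⟨y, rfl, hm⟩ := exists_mixes_of_mem_wickSpan (mem_wickSpan_of_mem_adjoin hy)
  exact ⟨y, hm, by rw [dist_eq_norm] at hxy; exact hxy⟩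

end Wick

/-! ### The vacuum state -/

theorem isState_vacuumExpectation (q : ℝ) (hq : |q| < 1) :
    IsState (vacuumExpectation q hq) := by
  refine ⟨vacuumExpectation_one, fun x => ?_⟩
  rw [vacuumExpectation_apply, MulMemClass.coe_mul, mul_apply_eq_comp,
    StarMemClass.coe_star, ContinuousLinearMap.star_eq_adjoint,
    ContinuousLinearMap.adjoint_inner_right, inner_self_eq_norm_sq_to_K]
  refine le_of_le_of_eq (Complex.zero_le_real.2
    (sq_nonneg ‖(x : Fock L2Z q hq →L[ℂ] Fock L2Z q hq) (vacuum L2Z q hq)‖)) ?_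
  push_cast
  rfl

theorem vacuumExpectation_shift (q : ℝ) (hq : |q| < 1) (x : Rq q hq) :
    vacuumExpectation q hq (shift q hq x) = vacuumExpectation q hq x := by
  set U := secondQuantization q hq bilateralShift with hU
  have h : U.symm (vacuum L2Z q hq) = vacuum L2Z q hq := by
    rw [LinearIsometryEquiv.symm_apply_eq, hU, secondQuantization_vacuum]
  rw [vacuumExpectation_apply, vacuumExpectation_apply, coe_shift,
    LinearIsometryEquiv.conjStarAlgEquiv_apply_apply, ← hU, h,
    ← U.inner_map_map (vacuum L2Z q hq) ((x : Fock L2Z q hq →L[ℂ] Fock L2Z q hq) (vacuum L2Z q hq)), hU,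
    secondQuantization_vacuum]

end QFock

theorem theorem3p3 (q : ℝ) (hq : |q| < 1) :
    QFock.UniquelyMixingWith (QFock.shift q hq) (QFock.vacuumExpectation q hq) ∧
      ∀ ψ : StrongDual ℂ (QFock.Rq q hq),
        (QFock.IsState ψ ∧ ∀ x : QFock.Rq q hq, ψ (QFock.shift q hq x) = ψ x) ↔
          ψ = QFock.vacuumExpectation q hq := by
  refine ⟨⟨QFock.isState_vacuumExpectation q hq, QFock.mixes⟩, fun ψ => ⟨?_, ?_⟩⟩
  · rintro ⟨hψ, hinv⟩
    ext x
    have h : ∀ n : ℕ, ψ ((QFock.shift q hq)^[n] x) = ψ x := by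
      intro n
      induction n with
      | zero => rfl
      | succ n ih => rw [Function.iterate_succ_apply', hinv, ih]
    have h1 := QFock.mixes x ψ
    simp only [h, hψ.1, one_mul] at h1
    exact tendsto_nhds_unique tendsto_const_nhds h1
  · rintro rfl
    exact ⟨QFock.isState_vacuumExpectation q hq, QFock.vacuumExpectation_shift q hq⟩
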